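/- Let $\langle S,A,P,\mu,\mathbf r,\gamma\rangle$ be a tabular (finite $S$, $A$) multi-objective MDP with $K$ objectives, transition law $P$, initial distribution $\mu$, reward $\mathbf r=(r_1,\dots,r_K):S\times A\to\mathbb R^K$ and discount factor $\gamma\in(0,1)$. Let $\Delta^K$ be the simplex of weight vectors and, for $\theta\in\mathbb R^{S\times A}$, let $\pi_\theta(a|s)=e^{\theta_{sa}}/\sum_{a'}e^{\theta_{sa'}}$. For a policy $\pi$, $w\in\Delta^K$ and $\tau>0$ put $V^\pi_k=\mathbb E_{\mu,\pi}[\sum_t\gamma^t r_k(s_t,a_t)]$, $\mathbf V^\pi=(V_1^\pi,\dots,V_K^\pi)$, $\tilde H(\pi)=\mathbb E_{\mu,\pi}[-\sum_t\gamma^t\log\pi(a_t|s_t)]$, $V^\pi_{w,\tau}(s)=\mathbb E_\pi[\sum_t\gamma^t(\langle w,\mathbf r(s_t,a_t)\rangle-\tau\log\pi(a_t|s_t))\mid s_0=s]$, and $Q^\pi_{w,\tau}(s,a)=\langle w,\mathbf r(s,a)\rangle+\gamma\,\mathbb E_{s'\sim P(\cdot|s,a)}[V^\pi_{w,\tau}(s')]$;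 let $Q^\pi_k$ be the (unregularized) action value for the reward $r_k$. For $\tau,\tau_w>0$, let $(\theta^*,w^*)$ be a Nash equilibrium of the zero-sum game in which the learner chooses $\theta$ to maximize, and the adversary chooses $w\in\Delta^K$ to minimize, $\langle w,\mathbf V^{\pi_\theta}\rangle+\tau\tilde H(\pi_\theta)-\tau_wH(w)$, where $H(w)=-\sum_k w(k)\log w(k)$; write $\pi^*=\pi_{\theta^*}$. At states $s$ with $\mu(s)=0$ (if any) assume in addition that $\pi^*$ is soft optimal for $\langle w^*,\mathbf r\rangle$, i.e. $V^{\pi_\theta}_{w^*,\tau}(s)\le V^{\pi^*}_{w^*,\tau}(s)$ for all $\theta$. Let estimates $\widehat Q^\pi_{w,\tau}$ and $\widehat Q^\pi_k$ be given with $\|\widehat Q^{\pi}_{w,\tau}-Q^{\pi}_{w,\tau}\|_\infty<\delta$ and $\|\widehat Q_k^{\pi}-Q_k^{\pi}\|_\infty<\delta$ for all $\pi,w,k$, and put $\widehat V^\pi_k=\sum_s\mu(s)\sum_a\pi(a|s)\widehat Q^\pi_k(s,a)$. Given step sizes $\eta,\lambda$, an initial parameter $\theta_0$ and an initial weight $w_0\in\Delta^K$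 with all entries positive, let $(\theta_t,w_t)$, with $\pi_t=\pi_{\theta_t}$, be generated by $$\pi_{t+1}(a|s)\propto\pi_t(a|s)^{\alpha}\exp\Big(\tfrac{1-\alpha}{\tau}\widehat Q^{\pi_t}_{w_t,\tau}(s,a)\Big),\qquad w_{t+1}=\mathrm{softmax}\Big(-\tfrac{1-\beta}{\tau_w}\widehat{\mathbf V}^{\pi_t}+\beta\log w_t\Big),$$ where $\alpha=1-\frac{\eta\tau}{1-\gamma}$ and $\beta=\frac1{\lambda\tau_w+1}$. Then there is $\epsilon_0>0$, depending only on $\gamma$, such that if $$\tau_w\ge\frac{12K(\max_{s,a,k}|r_k(s,a)|+\tau\log|A|)^2}{\tau(1-\gamma)^4},\qquad \epsilon\in(0,\epsilon_0),\qquad \eta=\frac{\epsilon(1-\gamma)}{\tau},\qquad \lambda=\frac{\epsilon^2}{\tau_w(1-\epsilon^2)},$$ then for all $t\ge 0$ \begin{align*} \|\log\pi^*-\log\pi_t\|_\infty&\le\widehat C_1[\widehat\rho(\eta,\lambda)]^t+\widehat D_1\delta/\epsilon^2,\\ \|w^*-w_t\|_\infty&\le\widehat C_2[\widehat\rho(\eta,\lambda)]^t+\widehat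 D_2\delta/\epsilon^2,\\ \|Q^{\pi^*}_{w^*,\tau}-Q^{\pi_t}_{w_t,\tau}\|_\infty&\le\widehat C_3[\widehat\rho(\eta,\lambda)]^t+\widehat D_3\delta/\epsilon^2, \end{align*} with $0<\widehat\rho(\eta,\lambda)<1-\frac{\epsilon^2}{2}<1$. Here $\widehat\rho$ (as a function of $\eta,\lambda$) and $\widehat D_1,\widehat D_2,\widehat D_3$ depend only on the MDP, $\tau$ and $\tau_w$, while $\widehat C_1,\widehat C_2,\widehat C_3$ may depend in addition on the equilibrium and on $(\theta_0,w_0)$; none of $\widehat C_i,\widehat D_i$ depends on $\epsilon$, $\delta$, the estimates or $t$. -/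

import Mathlib

/-- A tabular multi-objective Markov decision process with `K` objectives: transition law `P`,
initial state distribution `μ`, vector reward `r` and discount factor `γ ∈ (0, 1)`. -/
structure MOMDP (S A : Type*) [Fintype S] (K : ℕ) where
  P : S → A → stdSimplex ℝ S
  μ : stdSimplex ℝ S
  r : S → A → Fin K → ℝ
  γ : ℝ
  γ_pos : 0 < γ
  γ_lt_one : γ < 1

namespace MOMDP

/-- `softmax x = (exp x_i / ∑ j, exp x_j)_i`. -/
noncomputable def softmax {ι : Type*} [Fintype ι] (x : ι → ℝ) (i : ι) : ℝ :=
  Real.exp (x i) / ∑ j, Real.exp (x j)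

theorem softmax_mem_stdSimplex {ι : Type*} [Fintype ι] [Nonempty ι] (x : ι → ℝ) :
    softmax x ∈ stdSimplex ℝ ι := by
  have hpos : 0 < ∑ j, Real.exp (x j) :=
    Finset.sum_pos (fun j _ => Real.exp_pos _) Finset.univ_nonempty
  refine ⟨fun i => div_nonneg (Real.exp_pos _).le hpos.le, ?_⟩
  simp only [softmax]
  rw [← Finset.sum_div, div_self hpos.ne']

/-- Stationary stochastic policies; `π s a` is the probability of action `a` in state `s`. -/
abbrev Policy (S A : Type*) [Fintype A] := S → stdSimplex ℝ A

/-- The softmax policy `π_θ(a|s) = exp θ_{sa} / ∑ a', exp θ_{sa'}`. -/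
noncomputable def softmaxPolicy {S A : Type*} [Fintype A] [Nonempty A] (θ : S → A → ℝ) :
    Policy S A :=
  fun s => ⟨softmax (θ s), softmax_mem_stdSimplex (θ s)⟩

variable {S A : Type*} [Fintype S] [Fintype A] {K : ℕ}

/-- The law of the state `s_t` when `s_0` has law `ν` and actions are drawn from `π`. -/
noncomputable def stateLaw (M : MOMDP S A K) (π : Policy S A) (ν : S → ℝ) : ℕ → S → ℝ
  | 0 => ν
  | t + 1 => fun s' => ∑ s, ∑ a, stateLaw M π ν t s * π s a * M.P s a s'

/-- `E_{ν,π}[g(s_t, a_t)]`: here `s_t` has its law under `π`, and `a_t` is drawn from `π`. -/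
noncomputable def expectAt (M : MOMDP S A K) (π : Policy S A) (ν : S → ℝ) (g : S → A → ℝ)
    (t : ℕ) : ℝ :=
  ∑ s, ∑ a, stateLaw M π ν t s * π s a * g s a

/-- `E_{ν,π}[∑_t γ^t g(s_t, a_t)]`. -/
noncomputable def discounted (M : MOMDP S A K) (π : Policy S A) (ν : S → ℝ) (g : S → A → ℝ) : ℝ :=
  ∑' t : ℕ, M.γ ^ t * expectAt M π ν g t

open Classical in
/-- The discounted expected return from the initial state `s`. -/
noncomputable def discountedFrom (M : MOMDP S A K) (π : Policy S A) (g : S → A → ℝ) (s : S) : ℝ :=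
  discounted M π (Pi.single s 1) g

/-- The value `V^π_k` of objective `k`, from the initial distribution `μ`. -/
noncomputable def value (M : MOMDP S A K) (π : Policy S A) (k : Fin K) : ℝ :=
  discounted M π M.μ (fun s a => M.r s a k)

/-- The expected discounted cumulative entropy `E_{μ,π}[-∑_t γ^t log π(a_t|s_t)]`. -/
noncomputable def cumEntropy (M : MOMDP S A K) (π : Policy S A) : ℝ :=
  discounted M π M.μ (fun s a => -Real.log (π s a))

/-- The Shannon entropy of a weight vector. -/
noncomputable def weightEntropy (w : stdSimplex ℝ (Fin K)) : ℝ :=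
  -∑ k, w k * Real.log (w k)

/-- The action value `Q^π_k(s,a)` of objective `k`. -/
noncomputable def qValue (M : MOMDP S A K) (π : Policy S A) (k : Fin K) (s : S) (a : A) : ℝ :=
  M.r s a k + M.γ * ∑ s', M.P s a s' * discountedFrom M π (fun s a => M.r s a k) s'

/-- The soft state value `V^π_{w,τ}(s)` for the scalarized reward `⟨w, r⟩`. -/
noncomputable def softV (M : MOMDP S A K) (τ : ℝ) (π : Policy S A) (w : stdSimplex ℝ (Fin K))
    (s : S) : ℝ :=
  discountedFrom M π (fun s a => ∑ k, w k * M.r s a k - τ * Real.log (π s a)) s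

/-- The soft action value `Q^π_{w,τ}(s,a)` for the scalarized reward `⟨w, r⟩`. -/
noncomputable def softQ (M : MOMDP S A K) (τ : ℝ) (π : Policy S A) (w : stdSimplex ℝ (Fin K))
    (s : S) (a : A) : ℝ :=
  ∑ k, w k * M.r s a k + M.γ * ∑ s', M.P s a s' * softV M τ π w s'

/-- The learner's utility in the regularized zero-sum game,
`⟨w, V^π⟩ + τ H̃(π) - τ_w H(w)`; the adversary's utility is its negative. -/
noncomputable def utility (M : MOMDP S A K) (τ τw : ℝ) (π : Policy S A)
    (w : stdSimplex ℝ (Fin K)) : ℝ :=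
  ∑ k, w k * value M π k + τ * cumEntropy M π - τw * weightEntropy w

/-- `(θ, w)` is a Nash equilibrium of the regularized game: the learner plays policy
parameters, the adversary plays weight vectors. -/
def IsNash [Nonempty A] (M : MOMDP S A K) (τ τw : ℝ) (θ : S → A → ℝ)
    (w : stdSimplex ℝ (Fin K)) : Prop :=
  (∀ θ' : S → A → ℝ,
    utility M τ τw (softmaxPolicy θ') w ≤ utility M τ τw (softmaxPolicy θ) w) ∧
  ∀ w' : stdSimplex ℝ (Fin K),
    utility M τ τw (softmaxPolicy θ) w ≤ utility M τ τw (softmaxPolicy θ) w'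

/-- The estimate of `V^π_k` obtained from an estimate `q` of `Q^π_k`. -/
noncomputable def valueOfQ (M : MOMDP S A K) (π : Policy S A) (q : S → A → ℝ) : ℝ :=
  ∑ s, M.μ s * ∑ a, π s a * q s a

/-- `θ` and `w` are sequences generated by the algorithm with approximate policy evaluation:
the learner makes the tabular natural policy gradient step and the adversary the mirror descent
step in closed form, both with the estimated values. -/
structure IsRun [Nonempty A] (M : MOMDP S A K) (τ τw η lam : ℝ)
    (Qhat : Policy S A → stdSimplex ℝ (Fin K) → S → A → ℝ)
    (Qkhat : Policy S A → Fin K → S → A → ℝ)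
    (θ : ℕ → S → A → ℝ) (w : ℕ → stdSimplex ℝ (Fin K)) : Prop where
  policy_step : ∀ (t : ℕ) (s : S) (a : A),
    let α := 1 - η * τ / (1 - M.γ)
    let π := softmaxPolicy (θ t)
    softmaxPolicy (θ (t + 1)) s a =
      (π s a ^ α * Real.exp ((1 - α) / τ * Qhat π (w t) s a)) /
        ∑ a', π s a' ^ α * Real.exp ((1 - α) / τ * Qhat π (w t) s a')
  weight_step : ∀ (t : ℕ) (k : Fin K),
    let β := 1 / (lam * τw + 1)
    let π := softmaxPolicy (θ t)
    w (t + 1) k =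
      softmax (fun j => -((1 - β) / τw) * valueOfQ M π (Qkhat π j) + β * Real.log (w t j)) k

end MOMDP

/-! In logarithmic coordinates both players move affinely. With `π = softmax (f / τ)` and `w =
softmax ν`, a step replaces `f` by `(1 - ε) f + ε q` and `ν` by `(1 - ε²) ν - (ε² / τw) v`, where
`q` and `v` are the estimated soft action values and objective values. The equilibrium policy is the
softmax of its own soft action values `Q*` over `τ`, and the equilibrium weight is the softmax of
`-V* / τw`, so `Q*` and `-V* / τw` are the targets of `f` and `ν`.

Three errors are followed together: `x = ‖Q* - f‖`, the one-sided error `z = sup (f - Q)` with `Q`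
the current soft action values, and `y = ‖ν + V* / τw‖`. `IterateBound` bounds `x`, `z` and `b y` by
`3c / (1 - γ)`, `c` and `c`. One side of `f - Q` suffices: a mirror step improves the policy up to a
weight change and an estimation error (`softQ_sub_softQ_mirror_step_le`), while `Q` exceeds `Q*`
only through the weight error (`abs_softQ_sub_le`).

The weight `3 / (1 - γ)` on `x` leaves room to absorb `γ (x + z)` and the weight error. In `z` a
gain of order `ε` beats the drift of order `ε²` due to the moving weights; this is the use of two
time scales. In `y` the decay `1 - ε²` loses at most `ε² / 4` to the policy error, because `τw` is
large. Hence `IterateBound.step`: one step sends `c` to `(1 - 3ε² / 4) c + O(δ)`, and iterating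
gives the rate and the floor of order `δ / ε²`. Lipschitz bounds for softmax turn `x` and `y` into
errors of log-policy and weights. -/

namespace MOMDP

/-! ### Softmax, log-sum-exp and the Gibbs variational principle. -/

section Softmax

variable {ι : Type*} [Fintype ι]

/-- The log-sum-exp function. -/
noncomputable def logSumExp (x : ι → ℝ) : ℝ := Real.log (∑ i, Real.exp (x i))

theorem sum_exp_pos [Nonempty ι] (x : ι → ℝ) : 0 < ∑ i, Real.exp (x i) :=
  Finset.sum_pos (fun _ _ => Real.exp_pos _) Finset.univ_nonempty

theorem softmax_pos [Nonempty ι] (x : ι → ℝ) (i : ι) : 0 < softmax x i :=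
  div_pos (Real.exp_pos _) (sum_exp_pos x)

theorem log_softmax [Nonempty ι] (x : ι → ℝ) (i : ι) :
    Real.log (softmax x i) = x i - logSumExp x := by
  rw [softmax, Real.log_div (Real.exp_pos _).ne' (sum_exp_pos x).ne', Real.log_exp, logSumExp]

theorem sum_softmax [Nonempty ι] (x : ι → ℝ) : ∑ i, softmax x i = 1 :=
  (softmax_mem_stdSimplex x).2

theorem softmax_add_const (x : ι → ℝ) (c : ℝ) : softmax (fun i => x i + c) = softmax x := by
  funext i
  simp only [softmax, Real.exp_add, ← Finset.sum_mul]
  exact mul_div_mul_right _ _ (Real.exp_pos c).ne'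

theorem softmax_log {p : ι → ℝ} (hp : ∀ i, 0 < p i) (h1 : ∑ i, p i = 1) :
    softmax (fun i => Real.log (p i)) = p := by
  funext i
  simp [softmax, Real.exp_log (hp _), h1]

theorem logSumExp_le_add [Nonempty ι] {x y : ι → ℝ} {d : ℝ} (h : ∀ i, x i ≤ y i + d) :
    logSumExp x ≤ logSumExp y + d := by
  have h1 : ∑ i, Real.exp (x i) ≤ (∑ i, Real.exp (y i)) * Real.exp d := by
    rw [Finset.sum_mul]
    refine Finset.sum_le_sum fun i _ => ?_
    rw [← Real.exp_add]
    exact Real.exp_le_exp.2 (h i)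
  have h2 := Real.log_le_log (sum_exp_pos x) h1
  rwa [Real.log_mul (sum_exp_pos y).ne' (Real.exp_pos d).ne', Real.log_exp] at h2

theorem abs_log_softmax_sub_le [Nonempty ι] {x y : ι → ℝ} {d : ℝ} (h : ∀ i, |x i - y i| ≤ d)
    (i : ι) : |Real.log (softmax x i) - Real.log (softmax y i)| ≤ 2 * d := by
  have h1 : logSumExp x ≤ logSumExp y + d :=
    logSumExp_le_add fun i => by linarith [(abs_le.1 (h i)).2]
  have h2 : logSumExp y ≤ logSumExp x + d :=
    logSumExp_le_add fun i => by linarith [(abs_le.1 (h i)).1]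
  have h3 := abs_le.1 (h i)
  rw [log_softmax, log_softmax, abs_le]
  constructor <;> linarith

/-- The gap in the Gibbs variational principle, as a relative entropy. -/
theorem logSumExp_sub_eq_sum_klFun [Nonempty ι] (x : ι → ℝ) {p : ι → ℝ}
    (h1 : ∑ i, p i = 1) :
    logSumExp x - ∑ i, p i * (x i - Real.log (p i)) =
      ∑ i, softmax x i * InformationTheory.klFun (p i / softmax x i) := by
  have key : ∀ i, softmax x i * InformationTheory.klFun (p i / softmax x i) =
      p i * logSumExp x - p i * (x i - Real.log (p i)) + (softmax x i - p i) := by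
    intro i
    have hq := softmax_pos x i
    rcases eq_or_ne (p i) 0 with h0 | h0
    · simp [h0, InformationTheory.klFun]
    · rw [InformationTheory.klFun, Real.log_div h0 hq.ne', log_softmax]
      field_simp
      ring
  rw [Finset.sum_congr rfl fun i _ => key i, Finset.sum_add_distrib, Finset.sum_sub_distrib,
    Finset.sum_sub_distrib, ← Finset.sum_mul, h1, sum_softmax]
  ring

theorem gibbs_le_logSumExp [Nonempty ι] (x : ι → ℝ) {p : ι → ℝ} (hp : p ∈ stdSimplex ℝ ι) :
    ∑ i, p i * (x i - Real.log (p i)) ≤ logSumExp x := by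
  have h := logSumExp_sub_eq_sum_klFun x hp.2
  have h2 : 0 ≤ ∑ i, softmax x i * InformationTheory.klFun (p i / softmax x i) :=
    Finset.sum_nonneg fun i _ => mul_nonneg (softmax_pos x i).le
      (InformationTheory.klFun_nonneg (div_nonneg (hp.1 i) (softmax_pos x i).le))
  linarith

/-- The equality case of the Gibbs principle: a vanishing relative entropy forces every ratio `p i /
softmax x i` to be `1`, the only zero of `klFun` on the nonnegative reals. -/
theorem eq_softmax_of_logSumExp_le [Nonempty ι] (x : ι → ℝ) {p : ι → ℝ}
    (hp : p ∈ stdSimplex ℝ ι) (h : logSumExp x ≤ ∑ i, p i * (x i - Real.log (p i))) :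
    p = softmax x := by
  have h1 := logSumExp_sub_eq_sum_klFun x hp.2
  have h2 : ∀ i ∈ Finset.univ,
      0 ≤ softmax x i * InformationTheory.klFun (p i / softmax x i) :=
    fun i _ => mul_nonneg (softmax_pos x i).le
      (InformationTheory.klFun_nonneg (div_nonneg (hp.1 i) (softmax_pos x i).le))
  have h3 : ∑ i, softmax x i * InformationTheory.klFun (p i / softmax x i) = 0 :=
    le_antisymm (by linarith) (Finset.sum_nonneg h2)
  funext i
  have h4 := (Finset.sum_eq_zero_iff_of_nonneg h2).1 h3 i (Finset.mem_univ i)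
  have hq := softmax_pos x i
  rcases mul_eq_zero.1 h4 with h5 | h5
  · exact absurd h5 hq.ne'
  · rw [InformationTheory.klFun_eq_zero_iff (div_nonneg (hp.1 i) hq.le)] at h5
    exact (div_eq_one_iff_eq hq.ne').1 h5

theorem gibbs_softmax [Nonempty ι] (x : ι → ℝ) :
    ∑ i, softmax x i * (x i - Real.log (softmax x i)) = logSumExp x := by
  have : ∀ i, softmax x i * (x i - Real.log (softmax x i)) = softmax x i * logSumExp x := by
    intro i
    rw [log_softmax]
    ring
  rw [Finset.sum_congr rfl fun i _ => this i, ← Finset.sum_mul, sum_softmax, one_mul]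

/-- This is `2u / (u + 2) ≤ log (1 + u)` at `u = p / q - 1`. -/
theorem two_mul_sub_div_add_le_log {p q : ℝ} (hq : 0 < q) (h : q ≤ p) :
    2 * (p - q) / (p + q) ≤ Real.log p - Real.log q := by
  have hp : 0 < p := hq.trans_le h
  have h1 := Real.le_log_one_add_of_nonneg (x := p / q - 1)
    (by rw [sub_nonneg, le_div_iff₀ hq]; linarith)
  rw [add_sub_cancel, Real.log_div hp.ne' hq.ne'] at h1
  refine le_trans (le_of_eq ?_) h1
  have : p / q - 1 + 2 = (p + q) / q := by field_simp; ring
  rw [this]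
  field_simp

/-- The pointwise form of a Pinsker-type bound: summed over a pair of distributions, the right side
is the symmetrized relative entropy. -/
theorem two_mul_sq_div_add_le {p q : ℝ} (hp : 0 < p) (hq : 0 < q) :
    2 * ((p - q) ^ 2 / (p + q)) ≤ (p - q) * (Real.log p - Real.log q) := by
  rcases le_total q p with h | h
  · have := mul_le_mul_of_nonneg_left (two_mul_sub_div_add_le_log hq h) (sub_nonneg.2 h)
    refine le_trans (le_of_eq ?_) this
    ring
  · have := mul_le_mul_of_nonneg_left (two_mul_sub_div_add_le_log hp h) (sub_nonneg.2 h)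
    rw [add_comm q p] at this
    refine le_trans (le_of_eq ?_) (this.trans (le_of_eq ?_)) <;> ring

/-- Softmax is `1`-Lipschitz from the sup norm to the `ℓ¹` norm. -/
theorem sum_abs_softmax_sub_le [Nonempty ι] {x y : ι → ℝ} {d : ℝ}
    (h : ∀ i, |x i - y i| ≤ d) : ∑ i, |softmax x i - softmax y i| ≤ d := by
  set p := softmax x with hp
  set q := softmax y with hq
  have hpp : ∀ i, 0 < p i := softmax_pos x
  have hqp : ∀ i, 0 < q i := softmax_pos y
  set N := ∑ i, |p i - q i| with hN
  have hN0 : 0 ≤ N := Finset.sum_nonneg fun i _ => abs_nonneg _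
  have hd : 0 ≤ d := (abs_nonneg _).trans (h (Classical.arbitrary ι))
  -- Cauchy–Schwarz in Sedrakyan's form; the denominators `p i + q i` add up to `2`.
  have h1 : N ^ 2 / 2 ≤ ∑ i, (p i - q i) ^ 2 / (p i + q i) := by
    have := Finset.sq_sum_div_le_sum_sq_div Finset.univ (fun i => |p i - q i|)
      (g := fun i => p i + q i) (fun i _ => add_pos (hpp i) (hqp i))
    rw [Finset.sum_add_distrib, sum_softmax, sum_softmax] at this
    simp only [sq_abs] at this
    norm_num at this
    exact this
  have h2 : 2 * ∑ i, (p i - q i) ^ 2 / (p i + q i) ≤ ∑ i, (p i - q i) * (x i - y i) := by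
    -- The normalizing constants drop out because `p - q` sums to zero.
    have h3 : ∑ i, (p i - q i) * (x i - y i) =
        ∑ i, (p i - q i) * (Real.log (p i) - Real.log (q i)) := by
      have : ∀ i, (p i - q i) * (Real.log (p i) - Real.log (q i)) =
          (p i - q i) * (x i - y i) - (p i - q i) * (logSumExp x - logSumExp y) := by
        intro i
        rw [hp, hq, log_softmax, log_softmax]
        ring
      rw [Finset.sum_congr rfl fun i _ => this i, Finset.sum_sub_distrib, ← Finset.sum_mul,
        Finset.sum_sub_distrib, sum_softmax, sum_softmax]
      ring
    rw [h3, Finset.mul_sum]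
    exact Finset.sum_le_sum fun i _ => two_mul_sq_div_add_le (hpp i) (hqp i)
  have h4 : ∑ i, (p i - q i) * (x i - y i) ≤ N * d := by
    rw [hN, Finset.sum_mul]
    refine Finset.sum_le_sum fun i _ => (le_abs_self _).trans ?_
    rw [abs_mul]
    exact mul_le_mul_of_nonneg_left (h i) (abs_nonneg _)
  -- The three bounds combine to `N ^ 2 ≤ N * d`.
  rcases hN0.eq_or_lt with h0 | h0
  · rw [← h0]; exact hd
  · by_contra! hlt
    nlinarith

end Softmax

end MOMDP

/-! ### Policy evaluation: state laws, the Bellman equation and its comparison principle. -/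

namespace MOMDP

theorem simplex_nonneg {ι : Type*} [Fintype ι] (p : stdSimplex ℝ ι) (i : ι) : 0 ≤ p i := p.2.1 i

theorem simplex_sum {ι : Type*} [Fintype ι] (p : stdSimplex ℝ ι) : ∑ i, p i = 1 := p.2.2

theorem simplex_sum_mul_le {ι : Type*} [Fintype ι] (p : stdSimplex ℝ ι) {x : ι → ℝ} {c : ℝ}
    (h : ∀ i, x i ≤ c) : ∑ i, p i * x i ≤ c := by
  calc ∑ i, p i * x i ≤ ∑ i, p i * c :=
        Finset.sum_le_sum fun i _ => mul_le_mul_of_nonneg_left (h i) (simplex_nonneg p i)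
    _ = c := by rw [← Finset.sum_mul, simplex_sum, one_mul]

theorem le_simplex_sum_mul {ι : Type*} [Fintype ι] (p : stdSimplex ℝ ι) {x : ι → ℝ} {c : ℝ}
    (h : ∀ i, c ≤ x i) : c ≤ ∑ i, p i * x i := by
  have := simplex_sum_mul_le p (x := fun i => -x i) (c := -c) fun i => neg_le_neg (h i)
  simp only [mul_neg, Finset.sum_neg_distrib] at this
  linarith

theorem abs_simplex_sum_mul_le {ι : Type*} [Fintype ι] (p : stdSimplex ℝ ι) {x : ι → ℝ} {c : ℝ}
    (h : ∀ i, |x i| ≤ c) : |∑ i, p i * x i| ≤ c :=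
  abs_le.2 ⟨le_simplex_sum_mul p fun i => (abs_le.1 (h i)).1,
    simplex_sum_mul_le p fun i => (abs_le.1 (h i)).2⟩

theorem abs_sum_mul_le {ι : Type*} [Fintype ι] {u x : ι → ℝ} {d c : ℝ} (hc : 0 ≤ c)
    (hu : ∑ i, |u i| ≤ d) (hx : ∀ i, |x i| ≤ c) : |∑ i, u i * x i| ≤ d * c := by
  calc |∑ i, u i * x i| ≤ ∑ i, |u i| * c := by
        refine (Finset.abs_sum_le_sum_abs _ _).trans (Finset.sum_le_sum fun i _ => ?_)
        rw [abs_mul]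
        exact mul_le_mul_of_nonneg_left (hx i) (abs_nonneg _)
    _ ≤ d * c := by
        rw [← Finset.sum_mul]
        exact mul_le_mul_of_nonneg_right hu hc

variable {S A : Type*} [Fintype S] {K : ℕ}

theorem one_sub_γ_pos (M : MOMDP S A K) : 0 < 1 - M.γ := sub_pos.2 M.γ_lt_one

/-- Expected value of `U` at the next state. -/
noncomputable def nextValue (M : MOMDP S A K) (U : S → ℝ) (s : S) (a : A) : ℝ :=
  ∑ s', M.P s a s' * U s'

theorem nextValue_le (M : MOMDP S A K) {U : S → ℝ} {c : ℝ} (h : ∀ s, U s ≤ c) (s : S) (a : A) :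
    nextValue M U s a ≤ c :=
  simplex_sum_mul_le (M.P s a) h

theorem nextValue_sub (M : MOMDP S A K) (U W : S → ℝ) (s : S) (a : A) :
    nextValue M (fun s => U s - W s) s a = nextValue M U s a - nextValue M W s a := by
  simp only [nextValue, mul_sub, Finset.sum_sub_distrib]

variable [Fintype A]

/-- The recursion defining `stateLaw` peels off the last transition; the Bellman equation needs the
first one. -/
theorem stateLaw_succ' (M : MOMDP S A K) (π : Policy S A) (ν : S → ℝ) (t : ℕ) :
    stateLaw M π ν (t + 1) =
      stateLaw M π (fun s' => ∑ s, ∑ a, ν s * π s a * M.P s a s') t := by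
  induction t with
  | zero => rfl
  | succ t ih =>
    rw [stateLaw, ih]
    rfl

-- Linearity in the initial law reduces every discounted return to returns from point masses.
open Classical in
theorem stateLaw_eq_sum (M : MOMDP S A K) (π : Policy S A) (ν : S → ℝ) (t : ℕ) (s : S) :
    stateLaw M π ν t s = ∑ s₀, ν s₀ * stateLaw M π (Pi.single s₀ 1) t s := by
  induction t generalizing s with
  | zero => simp [stateLaw, Pi.single_apply]
  | succ t ih =>
    simp only [stateLaw, Finset.mul_sum]
    conv_rhs => rw [Finset.sum_comm]
    refine Finset.sum_congr rfl fun s' _ => ?_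
    conv_rhs => rw [Finset.sum_comm]
    refine Finset.sum_congr rfl fun a _ => ?_
    rw [ih, Finset.sum_mul, Finset.sum_mul]
    exact Finset.sum_congr rfl fun _ _ => by ring

/-- A stochastic kernel contracts the `ℓ¹` norm. Since `ν` may be any signed vector, this replaces
conservation of mass in the proof of summability. -/
theorem sum_abs_stateLaw_le (M : MOMDP S A K) (π : Policy S A) (ν : S → ℝ) (t : ℕ) :
    ∑ s, |stateLaw M π ν t s| ≤ ∑ s, |ν s| := by
  induction t with
  | zero => exact le_rfl
  | succ t ih =>
    refine le_trans ?_ ih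
    calc ∑ s', |stateLaw M π ν (t + 1) s'|
        ≤ ∑ s', ∑ s, ∑ a, |stateLaw M π ν t s| * π s a * M.P s a s' := by
          refine Finset.sum_le_sum fun s' _ => ?_
          refine (Finset.abs_sum_le_sum_abs _ _).trans (Finset.sum_le_sum fun s _ => ?_)
          refine (Finset.abs_sum_le_sum_abs _ _).trans (Finset.sum_le_sum fun a _ => ?_)
          rw [abs_mul, abs_mul, abs_of_nonneg (simplex_nonneg (π s) a),
            abs_of_nonneg (simplex_nonneg (M.P s a) s')]
      _ = ∑ s, |stateLaw M π ν t s| := by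
          rw [Finset.sum_comm]
          refine Finset.sum_congr rfl fun s _ => ?_
          rw [Finset.sum_comm]
          simp only [← Finset.mul_sum, simplex_sum, mul_one]

theorem abs_expectAt_le (M : MOMDP S A K) (π : Policy S A) (ν : S → ℝ) (g : S → A → ℝ) (t : ℕ) :
    |expectAt M π ν g t| ≤ (∑ s, |ν s|) * ∑ s, ∑ a, |g s a| := by
  have hg : 0 ≤ ∑ s, ∑ a, |g s a| :=
    Finset.sum_nonneg fun s _ => Finset.sum_nonneg fun a _ => abs_nonneg _
  have heq : expectAt M π ν g t = ∑ s, stateLaw M π ν t s * ∑ a, π s a * g s a := by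
    simp only [expectAt, Finset.mul_sum, mul_assoc]
  rw [heq]
  refine abs_sum_mul_le hg (sum_abs_stateLaw_le M π ν t) fun s => ?_
  refine abs_simplex_sum_mul_le (π s) fun a => ?_
  calc |g s a| ≤ ∑ a, |g s a| :=
        Finset.single_le_sum (f := fun a => |g s a|) (fun _ _ => abs_nonneg _) (Finset.mem_univ a)
    _ ≤ ∑ s, ∑ a, |g s a| :=
        Finset.single_le_sum (f := fun s => ∑ a, |g s a|)
          (fun _ _ => Finset.sum_nonneg fun _ _ => abs_nonneg _) (Finset.mem_univ s)

theorem summable_discounted (M : MOMDP S A K) (π : Policy S A) (ν : S → ℝ) (g : S → A → ℝ) :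
    Summable fun t : ℕ => M.γ ^ t * expectAt M π ν g t := by
  refine Summable.of_norm_bounded (g := fun t => M.γ ^ t * ((∑ s, |ν s|) * ∑ s, ∑ a, |g s a|))
    ((summable_geometric_of_lt_one M.γ_pos.le M.γ_lt_one).mul_right _) fun t => ?_
  rw [Real.norm_eq_abs, abs_mul, abs_of_pos (pow_pos M.γ_pos t)]
  exact mul_le_mul_of_nonneg_left (abs_expectAt_le M π ν g t) (pow_pos M.γ_pos t).le

open Classical in
theorem discounted_eq_sum (M : MOMDP S A K) (π : Policy S A) (ν : S → ℝ) (g : S → A → ℝ) :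
    discounted M π ν g = ∑ s, ν s * discountedFrom M π g s := by
  have h1 : ∀ t, M.γ ^ t * expectAt M π ν g t =
      ∑ s₀, ν s₀ * (M.γ ^ t * expectAt M π (Pi.single s₀ 1) g t) := by
    intro t
    simp only [expectAt, Finset.mul_sum]
    conv_rhs => rw [Finset.sum_comm]
    refine Finset.sum_congr rfl fun s _ => ?_
    conv_rhs => rw [Finset.sum_comm]
    refine Finset.sum_congr rfl fun a _ => ?_
    rw [stateLaw_eq_sum, Finset.sum_mul, Finset.sum_mul, Finset.mul_sum]
    exact Finset.sum_congr rfl fun _ _ => by ring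
  simp only [discounted, discountedFrom]
  rw [tsum_congr h1, Summable.tsum_finsetSum
    fun s₀ _ => (summable_discounted M π (Pi.single s₀ 1) g).mul_left _]
  exact Finset.sum_congr rfl fun s₀ _ => tsum_mul_left

open Classical in
/-- The Bellman equation for policy evaluation. -/
theorem discountedFrom_bellman (M : MOMDP S A K) (π : Policy S A) (g : S → A → ℝ) (s : S) :
    discountedFrom M π g s =
      ∑ a, π s a * (g s a + M.γ * nextValue M (discountedFrom M π g) s a) := by
  have h1 : discountedFrom M π g s = expectAt M π (Pi.single s 1) g 0 +
      M.γ * discounted M π (fun s' => ∑ a, π s a * M.P s a s') g := by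
    rw [discountedFrom, discounted, (summable_discounted M π (Pi.single s 1) g).tsum_eq_zero_add,
      pow_zero, one_mul, discounted, ← tsum_mul_left]
    congr 1
    refine tsum_congr fun t => ?_
    have : (fun s' => ∑ s₀, ∑ a, (Pi.single s 1 : S → ℝ) s₀ * π s₀ a * M.P s₀ a s') =
        fun s' => ∑ a, π s a * M.P s a s' := by
      funext s'
      rw [Finset.sum_eq_single s (fun b _ hb => by simp [hb]) (by simp)]
      simp
    rw [pow_succ', mul_assoc, expectAt, stateLaw_succ', this, expectAt]
  have h2 : expectAt M π (Pi.single s 1) g 0 = ∑ a, π s a * g s a := by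
    rw [expectAt, Finset.sum_eq_single s (fun b _ hb => by simp [stateLaw, hb]) (by simp)]
    simp [stateLaw]
  rw [h1, h2, discounted_eq_sum]
  simp only [mul_add, Finset.sum_add_distrib, nextValue, Finset.sum_mul, Finset.mul_sum]
  congr 1
  rw [Finset.sum_comm]
  exact Finset.sum_congr rfl fun _ _ => Finset.sum_congr rfl fun _ _ => by ring

/-- Comparison principle for the policy evaluation operator. -/
theorem le_div_of_le_bellman (M : MOMDP S A K) (π : Policy S A) {D : S → ℝ} {c : ℝ}
    (h : ∀ s, D s ≤ c + M.γ * ∑ a, π s a * nextValue M D s a) (s : S) :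
    D s ≤ c / (1 - M.γ) := by
  have : Nonempty S := ⟨s⟩
  -- Maximum principle: at a maximizer the averaged next value is at most `D m`, so `D m ≤ c + γ * D
  -- m`.
  obtain ⟨m, hm⟩ := Finite.exists_max D
  have h1 : ∑ a, π m a * nextValue M D m a ≤ D m :=
    simplex_sum_mul_le (π m) fun a => nextValue_le M hm m a
  have h2 := mul_le_mul_of_nonneg_left h1 M.γ_pos.le
  refine (hm s).trans ?_
  rw [le_div_iff₀ (one_sub_γ_pos M)]
  linarith [h m]

/-- Uniqueness for the Bellman equation, by comparison in both directions. Linearity of returns in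
the reward then follows without manipulating series. -/
theorem eq_discountedFrom_of_bellman (M : MOMDP S A K) (π : Policy S A) (g : S → A → ℝ)
    {U : S → ℝ} (h : ∀ s, U s = ∑ a, π s a * (g s a + M.γ * nextValue M U s a)) (s : S) :
    U s = discountedFrom M π g s := by
  have key : ∀ U W : S → ℝ, (∀ s, U s = ∑ a, π s a * (g s a + M.γ * nextValue M U s a)) →
      (∀ s, W s = ∑ a, π s a * (g s a + M.γ * nextValue M W s a)) → U s ≤ W s := by
    intro U W hU hW
    have := le_div_of_le_bellman M π (D := fun s => U s - W s) (c := 0) (fun s => ?_) s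
    · simp only [zero_div] at this
      linarith
    · simp only [nextValue_sub]
      rw [hU s, hW s, ← Finset.sum_sub_distrib, zero_add, Finset.mul_sum]
      exact le_of_eq (Finset.sum_congr rfl fun _ _ => by ring)
  exact le_antisymm (key _ _ h (discountedFrom_bellman M π g))
    (key _ _ (discountedFrom_bellman M π g) h)

theorem discountedFrom_add (M : MOMDP S A K) (π : Policy S A) (g h : S → A → ℝ) (s : S) :
    discountedFrom M π (fun s a => g s a + h s a) s =
      discountedFrom M π g s + discountedFrom M π h s := by
  refine (eq_discountedFrom_of_bellman M π _
    (U := fun s => discountedFrom M π g s + discountedFrom M π h s) (fun s => ?_) s).symm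
  rw [discountedFrom_bellman M π g s, discountedFrom_bellman M π h s, ← Finset.sum_add_distrib]
  refine Finset.sum_congr rfl fun a _ => ?_
  simp only [nextValue, mul_add, Finset.sum_add_distrib]
  ring

theorem discountedFrom_const_mul (M : MOMDP S A K) (π : Policy S A) (c : ℝ) (g : S → A → ℝ)
    (s : S) : discountedFrom M π (fun s a => c * g s a) s = c * discountedFrom M π g s := by
  refine (eq_discountedFrom_of_bellman M π _
    (U := fun s => c * discountedFrom M π g s) (fun s => ?_) s).symm
  rw [discountedFrom_bellman M π g s, Finset.mul_sum]
  refine Finset.sum_congr rfl fun a _ => ?_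
  have : nextValue M (fun s => c * discountedFrom M π g s) s a =
      c * nextValue M (discountedFrom M π g) s a := by
    simp only [nextValue, Finset.mul_sum]
    exact Finset.sum_congr rfl fun _ _ => by ring
  rw [this]
  ring

theorem discountedFrom_sum {ι : Type*} (M : MOMDP S A K) (π : Policy S A) (I : Finset ι)
    (g : ι → S → A → ℝ) (s : S) :
    discountedFrom M π (fun s a => ∑ i ∈ I, g i s a) s = ∑ i ∈ I, discountedFrom M π (g i) s := by
  classical
  induction I using Finset.induction_on with
  | empty =>
    simp only [Finset.sum_empty]
    simpa using discountedFrom_const_mul M π 0 (fun _ _ => 0) s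
  | insert i I hi ih =>
    simp only [Finset.sum_insert hi]
    rw [discountedFrom_add, ih]

end MOMDP

/-! ### The Gibbs principle at temperature `τ`. -/

namespace MOMDP

section ScaledGibbs

variable {ι : Type*} [Fintype ι]

/-- The soft maximum of `x` at temperature `τ`. -/
noncomputable def softMaximum (τ : ℝ) (x : ι → ℝ) : ℝ := τ * logSumExp fun i => x i / τ

theorem sum_mul_sub_mul_log {τ : ℝ} (hτ : 0 < τ) (p x : ι → ℝ) :
    ∑ i, p i * (x i - τ * Real.log (p i)) = τ * ∑ i, p i * (x i / τ - Real.log (p i)) := by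
  rw [Finset.mul_sum]
  refine Finset.sum_congr rfl fun i _ => ?_
  field_simp

theorem gibbs_le_softMaximum [Nonempty ι] {τ : ℝ} (hτ : 0 < τ) (x : ι → ℝ) (p : stdSimplex ℝ ι) :
    ∑ i, p i * (x i - τ * Real.log (p i)) ≤ softMaximum τ x := by
  rw [sum_mul_sub_mul_log hτ p x]
  exact mul_le_mul_of_nonneg_left (gibbs_le_logSumExp _ p.2) hτ.le

theorem eq_softmax_of_softMaximum_le [Nonempty ι] {τ : ℝ} (hτ : 0 < τ) (x : ι → ℝ)
    (p : stdSimplex ℝ ι) (h : softMaximum τ x ≤ ∑ i, p i * (x i - τ * Real.log (p i))) :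
    (p : ι → ℝ) = softmax fun i => x i / τ := by
  rw [sum_mul_sub_mul_log hτ p x] at h
  exact eq_softmax_of_logSumExp_le _ p.2 (le_of_mul_le_mul_left h hτ)

theorem gibbs_softmax_eq_softMaximum [Nonempty ι] {τ : ℝ} (hτ : 0 < τ) (x : ι → ℝ) {p : ι → ℝ}
    (hp : p = softmax fun i => x i / τ) :
    ∑ i, p i * (x i - τ * Real.log (p i)) = softMaximum τ x := by
  rw [sum_mul_sub_mul_log hτ p x, hp, gibbs_softmax, softMaximum]

theorem softMaximum_le_add [Nonempty ι] {τ : ℝ} (hτ : 0 < τ) {x y : ι → ℝ} {d : ℝ}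
    (h : ∀ i, x i ≤ y i + d) : softMaximum τ x ≤ softMaximum τ y + d := by
  have h1 : logSumExp (fun i => x i / τ) ≤ logSumExp (fun i => y i / τ) + d / τ :=
    logSumExp_le_add fun i => by
      rw [← add_div]
      exact div_le_div_of_nonneg_right (h i) hτ.le
  have h2 := mul_le_mul_of_nonneg_left h1 hτ.le
  rwa [mul_add, mul_div_cancel₀ _ hτ.ne'] at h2

/-- A mirror ascent step for the entropy-regularized linear objective improves it. -/
theorem gibbs_le_gibbs_mirror_step [Nonempty ι] {τ ε : ℝ} (hτ : 0 < τ) (hε : 0 < ε) (hε1 : ε ≤ 1)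
    (f q : ι → ℝ) (p p' : stdSimplex ℝ ι) (hp : (p : ι → ℝ) = softmax fun i => f i / τ)
    (hp' : (p' : ι → ℝ) = softmax fun i => ((1 - ε) * f i + ε * q i) / τ) :
    ∑ i, p i * (q i - τ * Real.log (p i)) ≤ ∑ i, p' i * (q i - τ * Real.log (p' i)) := by
  -- The objective that `p'` maximizes is a convex combination of the regularized objectives for `f`
  -- and `q`. As `p` is already optimal for `f`, the gain of `p'` over `p` must come from the `q`
  -- part.
  have split : ∀ u : stdSimplex ℝ ι,
      ∑ i, u i * (((1 - ε) * f i + ε * q i) - τ * Real.log (u i)) =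
        (1 - ε) * ∑ i, u i * (f i - τ * Real.log (u i)) +
          ε * ∑ i, u i * (q i - τ * Real.log (u i)) := by
    intro u
    rw [Finset.mul_sum, Finset.mul_sum, ← Finset.sum_add_distrib]
    exact Finset.sum_congr rfl fun _ _ => by ring
  have h1 := gibbs_le_softMaximum hτ (fun i => (1 - ε) * f i + ε * q i) p
  rw [← gibbs_softmax_eq_softMaximum hτ _ hp', split, split] at h1
  have h2 := gibbs_le_softMaximum hτ f p'
  rw [← gibbs_softmax_eq_softMaximum hτ _ hp] at h2
  have h3 := mul_le_mul_of_nonneg_left h2 (sub_nonneg.2 hε1)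
  exact le_of_mul_le_mul_left (by linarith) hε

theorem simplex_sum_mul_le_add (p : stdSimplex ℝ ι) {x y : ι → ℝ} {c : ℝ}
    (h : ∀ i, x i ≤ y i + c) : ∑ i, p i * x i ≤ ∑ i, p i * y i + c := by
  have := simplex_sum_mul_le p (x := fun i => x i - y i) (c := c) fun i => by linarith [h i]
  simp only [mul_sub, Finset.sum_sub_distrib] at this
  linarith

end ScaledGibbs

/-! ### Soft values and policy improvement. -/

variable {S A : Type*} [Fintype S] {K : ℕ}

/-- The scalarized reward `⟨w, r(s, a)⟩`. -/
noncomputable def scalarReward (M : MOMDP S A K) (w : stdSimplex ℝ (Fin K)) (s : S) (a : A) : ℝ :=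
  ∑ k, w k * M.r s a k

variable [Fintype A]

theorem abs_apply_le_norm {S A : Type*} [Fintype S] [Fintype A] (q : S → A → ℝ) (s : S) (a : A) :
    |q s a| ≤ ‖q‖ :=
  (norm_le_pi_norm (q s) a).trans (norm_le_pi_norm q s)

theorem abs_r_le (M : MOMDP S A K) (s : S) (a : A) (k : Fin K) : |M.r s a k| ≤ ‖M.r‖ :=
  (norm_le_pi_norm (M.r s a) k).trans ((norm_le_pi_norm (M.r s) a).trans (norm_le_pi_norm M.r s))

theorem abs_scalarReward_sub_le (M : MOMDP S A K) {w w' : stdSimplex ℝ (Fin K)} {d : ℝ}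
    (h : ∑ k, |w k - w' k| ≤ d) (s : S) (a : A) :
    |scalarReward M w s a - scalarReward M w' s a| ≤ d * ‖M.r‖ := by
  simp only [scalarReward]
  rw [← Finset.sum_sub_distrib]
  simp only [← sub_mul]
  exact abs_sum_mul_le (norm_nonneg _) h fun k => abs_r_le M s a k

theorem softQ_eq (M : MOMDP S A K) (τ : ℝ) (π : Policy S A) (w : stdSimplex ℝ (Fin K))
    (s : S) (a : A) :
    softQ M τ π w s a = scalarReward M w s a + M.γ * nextValue M (softV M τ π w) s a := rfl

theorem softV_eq (M : MOMDP S A K) (τ : ℝ) (π : Policy S A) (w : stdSimplex ℝ (Fin K)) (s : S) :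
    softV M τ π w s = ∑ a, π s a * (softQ M τ π w s a - τ * Real.log (π s a)) := by
  rw [softV, discountedFrom_bellman]
  refine Finset.sum_congr rfl fun a _ => ?_
  rw [softQ_eq]
  change _ * (scalarReward M w s a - _ + M.γ * nextValue M (softV M τ π w) s a) = _
  ring

/-- An approximate supersolution of the soft evaluation equation dominates the soft value; a defect
of `c` per step accumulates to `c / (1 - γ)`. The next lemma is its counterpart for subsolutions. -/
theorem softV_le_of_bellman_le (M : MOMDP S A K) (τ : ℝ) (π : Policy S A)
    (w : stdSimplex ℝ (Fin K)) {U : S → ℝ} {c : ℝ}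
    (h : ∀ s, ∑ a, π s a * (scalarReward M w s a + M.γ * nextValue M U s a
      - τ * Real.log (π s a)) ≤ U s + c) (s : S) :
    softV M τ π w s ≤ U s + c / (1 - M.γ) := by
  have := le_div_of_le_bellman M π (D := fun s => softV M τ π w s - U s) (c := c) (fun s => ?_) s
  · linarith
  · have h1 : softV M τ π w s - ∑ a, π s a * (scalarReward M w s a + M.γ * nextValue M U s a
        - τ * Real.log (π s a)) =
        M.γ * ∑ a, π s a * nextValue M (fun s => softV M τ π w s - U s) s a := by
      rw [softV_eq, ← Finset.sum_sub_distrib, Finset.mul_sum]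
      refine Finset.sum_congr rfl fun a _ => ?_
      rw [nextValue_sub, softQ_eq]
      ring
    rw [← h1]
    linarith [h s]

theorem le_softV_of_le_bellman (M : MOMDP S A K) (τ : ℝ) (π : Policy S A)
    (w : stdSimplex ℝ (Fin K)) {U : S → ℝ} {c : ℝ}
    (h : ∀ s, U s ≤ ∑ a, π s a * (scalarReward M w s a + M.γ * nextValue M U s a
      - τ * Real.log (π s a)) + c) (s : S) :
    U s ≤ softV M τ π w s + c / (1 - M.γ) := by
  have := le_div_of_le_bellman M π (D := fun s => U s - softV M τ π w s) (c := c) (fun s => ?_) s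
  · linarith
  · have h1 : ∑ a, π s a * (scalarReward M w s a + M.γ * nextValue M U s a
        - τ * Real.log (π s a)) - softV M τ π w s =
        M.γ * ∑ a, π s a * nextValue M (fun s => U s - softV M τ π w s) s a := by
      rw [softV_eq, ← Finset.sum_sub_distrib, Finset.mul_sum]
      refine Finset.sum_congr rfl fun a _ => ?_
      rw [nextValue_sub, softQ_eq]
      ring
    rw [← h1]
    linarith [h s]

theorem softQ_sub_softQ_le (M : MOMDP S A K) (τ : ℝ) (π π' : Policy S A)
    {w w' : stdSimplex ℝ (Fin K)} {d c : ℝ} (hd : ∑ k, |w k - w' k| ≤ d)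
    (h : ∀ s, softV M τ π w s - softV M τ π' w' s ≤ c) (s : S) (a : A) :
    softQ M τ π w s a - softQ M τ π' w' s a ≤ d * ‖M.r‖ + M.γ * c := by
  have h1 := (abs_le.1 (abs_scalarReward_sub_le M hd s a)).2
  have h2 := mul_le_mul_of_nonneg_left
    (nextValue_le M (U := fun s => softV M τ π w s - softV M τ π' w' s) h s a) M.γ_pos.le
  rw [nextValue_sub] at h2
  rw [softQ_eq, softQ_eq]
  linarith

/-- The policy that is greedy for the soft action values of `π` dominates one soft Bellman
backup of the value of `π`. -/
theorem softMaximum_softQ_le_softV_greedy [Nonempty A] (M : MOMDP S A K) {τ : ℝ} (hτ : 0 < τ)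
    (π : Policy S A) (w : stdSimplex ℝ (Fin K)) (s : S) :
    softMaximum τ (softQ M τ π w s) ≤
      softV M τ (softmaxPolicy fun s a => softQ M τ π w s a / τ) w s := by
  set π' : Policy S A := softmaxPolicy fun s a => softQ M τ π w s a / τ with hπ'
  have hg : ∀ s, ∑ a, π' s a * (softQ M τ π w s a - τ * Real.log (π' s a)) =
      softMaximum τ (softQ M τ π w s) := fun s => gibbs_softmax_eq_softMaximum hτ _ rfl
  -- Policy improvement: the greedy policy attains the soft maximum, so the value of `π` is a
  -- subsolution for `π'`.
  have h1 : ∀ s, softV M τ π w s ≤ softV M τ π' w s := by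
    intro s
    have := le_softV_of_le_bellman M τ π' w (U := softV M τ π w) (c := 0) (fun s => ?_) s
    · simpa using this
    · simp only [← softQ_eq]
      rw [hg, softV_eq, add_zero]
      exact gibbs_le_softMaximum hτ _ (π s)
  rw [← hg, softV_eq M τ π' w s]
  refine Finset.sum_le_sum fun a _ => mul_le_mul_of_nonneg_left ?_ (simplex_nonneg _ a)
  have := softQ_sub_softQ_le M τ π π' (w := w) (w' := w) (d := 0) (c := 0) (by simp)
    (fun s => by linarith [h1 s]) s a
  linarith

/-- If the greedy policy gains nothing at `s`, then `π s` attains the soft maximum there, and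
equality in the Gibbs principle identifies it. The hypothesis at the single state `s` is enough. -/
theorem eq_softmax_softQ_of_le [Nonempty A] (M : MOMDP S A K) {τ : ℝ} (hτ : 0 < τ)
    (π : Policy S A) (w : stdSimplex ℝ (Fin K)) (s : S)
    (h : softV M τ (softmaxPolicy fun s a => softQ M τ π w s a / τ) w s ≤ softV M τ π w s) :
    (π s : A → ℝ) = softmax fun a => softQ M τ π w s a / τ := by
  refine eq_softmax_of_softMaximum_le hτ _ (π s) ?_
  rw [← softV_eq]
  exact (softMaximum_softQ_le_softV_greedy M hτ π w s).trans h

/-! ### First-order characterization of the equilibrium. -/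

theorem utility_eq (M : MOMDP S A K) (τ τw : ℝ) (π : Policy S A) (w : stdSimplex ℝ (Fin K)) :
    utility M τ τw π w = ∑ s, M.μ s * softV M τ π w s - τw * weightEntropy w := by
  rw [utility]
  congr 1
  have h : ∀ s, softV M τ π w s =
      ∑ k, w k * discountedFrom M π (fun s a => M.r s a k) s +
        τ * discountedFrom M π (fun s a => -Real.log (π s a)) s := by
    intro s
    simp only [← discountedFrom_const_mul]
    rw [← discountedFrom_sum, ← discountedFrom_add, softV]
    congr 1
    funext s a
    ring
  simp only [value, cumEntropy, discounted_eq_sum, h, mul_add, Finset.sum_add_distrib,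
    Finset.mul_sum]
  congr 1
  · rw [Finset.sum_comm]
    exact Finset.sum_congr rfl fun _ _ => Finset.sum_congr rfl fun _ _ => by ring
  · exact Finset.sum_congr rfl fun _ _ => by ring

/-- At a Nash equilibrium whose policy is soft optimal off the support of `μ`, the policy is the
softmax of its own soft action values. -/
theorem IsNash.policy_eq_softmax [Nonempty A] {M : MOMDP S A K} {τ τw : ℝ} (hτ : 0 < τ)
    {θ : S → A → ℝ} {w : stdSimplex ℝ (Fin K)} (hN : IsNash M τ τw θ w)
    (hsel : ∀ s, M.μ s = 0 → ∀ θ' : S → A → ℝ,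
      softV M τ (softmaxPolicy θ') w s ≤ softV M τ (softmaxPolicy θ) w s) (s : S) :
    (softmaxPolicy θ s : A → ℝ) =
      softmax fun a => softQ M τ (softmaxPolicy θ) w s a / τ := by
  refine eq_softmax_softQ_of_le M hτ _ w s ?_
  set θ' : S → A → ℝ := fun s a => softQ M τ (softmaxPolicy θ) w s a / τ
  rcases (simplex_nonneg M.μ s).eq_or_lt with h0 | h0
  · exact hsel s h0.symm θ'
  · have h1 := hN.1 θ'
    rw [utility_eq, utility_eq] at h1
    -- The greedy policy improves at every state, so the averaged gain, which the equilibrium makes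
    -- nonpositive, is a sum of nonnegative terms; a state charged by `μ` therefore has no gain.
    have hle : ∀ s, softV M τ (softmaxPolicy θ) w s ≤ softV M τ (softmaxPolicy θ') w s := by
      intro s
      refine le_trans ?_ (softMaximum_softQ_le_softV_greedy M hτ (softmaxPolicy θ) w s)
      rw [softV_eq]
      exact gibbs_le_softMaximum hτ _ _
    have h2 : ∑ s, M.μ s * (softV M τ (softmaxPolicy θ') w s - softV M τ (softmaxPolicy θ) w s)
        ≤ 0 := by
      simp only [mul_sub, Finset.sum_sub_distrib]
      linarith
    have h3 := Finset.single_le_sum (f := fun s => M.μ s *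
      (softV M τ (softmaxPolicy θ') w s - softV M τ (softmaxPolicy θ) w s))
      (fun s _ => mul_nonneg (simplex_nonneg _ _) (sub_nonneg.2 (hle s))) (Finset.mem_univ s)
    have h4 := h3.trans h2
    by_contra! hlt
    exact absurd (mul_pos h0 (sub_pos.2 hlt)) (not_lt.2 h4)

/-- Up to a constant independent of the weight, the adversary maximizes the Gibbs functional of `-V`
at temperature `τw`. Comparison with the softmax weight yields the equality case. -/
theorem IsNash.weight_eq_softmax [Nonempty A] {M : MOMDP S A K} {τ τw : ℝ} (hτw : 0 < τw)
    {θ : S → A → ℝ} {w : stdSimplex ℝ (Fin K)} (hN : IsNash M τ τw θ w) :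
    (w : Fin K → ℝ) = softmax fun k => -value M (softmaxPolicy θ) k / τw := by
  set V := value M (softmaxPolicy θ)
  have : Nonempty (Fin K) := by
    by_contra h
    rw [not_nonempty_iff] at h
    simpa using simplex_sum w
  refine eq_softmax_of_softMaximum_le hτw (fun k => -V k) w ?_
  have h1 := hN.2 ⟨softmax fun k => -V k / τw, softmax_mem_stdSimplex _⟩
  set q : stdSimplex ℝ (Fin K) := ⟨softmax fun k => -V k / τw, softmax_mem_stdSimplex _⟩
  rw [← gibbs_softmax_eq_softMaximum hτw _ (p := q) rfl]
  have h2 : ∀ u : stdSimplex ℝ (Fin K), ∑ k, u k * (-V k - τw * Real.log (u k)) =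
      τ * cumEntropy M (softmaxPolicy θ) - utility M τ τw (softmaxPolicy θ) u := by
    intro u
    rw [utility, weightEntropy]
    simp only [mul_sub, Finset.sum_sub_distrib, mul_neg, Finset.sum_neg_distrib, Finset.mul_sum]
    have : ∑ k, u k * (τw * Real.log (u k)) = ∑ k, τw * (u k * Real.log (u k)) :=
      Finset.sum_congr rfl fun _ _ => by ring
    rw [this]
    ring
  rw [h2, h2]
  linarith

/-! ### Stability of values under changes of policy and weight. -/

theorem abs_discountedFrom_le (M : MOMDP S A K) (π : Policy S A) {g : S → A → ℝ} {c : ℝ}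
    (h : ∀ s a, |g s a| ≤ c) (s : S) : |discountedFrom M π g s| ≤ c / (1 - M.γ) := by
  have key : ∀ g : S → A → ℝ, (∀ s a, |g s a| ≤ c) →
      discountedFrom M π g s ≤ c / (1 - M.γ) := by
    intro g h
    refine le_div_of_le_bellman M π (fun s => ?_) s
    rw [discountedFrom_bellman]
    simp only [mul_add, Finset.sum_add_distrib]
    refine add_le_add (simplex_sum_mul_le (π s) fun a => (abs_le.1 (h s a)).2) (le_of_eq ?_)
    rw [Finset.mul_sum]
    exact Finset.sum_congr rfl fun _ _ => by ring
  refine abs_le.2 ⟨?_, key g h⟩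
  have h1 := key (fun s a => -1 * g s a) fun s a => by simpa using h s a
  rw [discountedFrom_const_mul] at h1
  linarith

theorem qValue_eq (M : MOMDP S A K) (π : Policy S A) (k : Fin K) (s : S) (a : A) :
    qValue M π k s a =
      M.r s a k + M.γ * nextValue M (discountedFrom M π fun s a => M.r s a k) s a := rfl

theorem abs_qValue_le (M : MOMDP S A K) (π : Policy S A) (k : Fin K) (s : S) (a : A) :
    |qValue M π k s a| ≤ ‖M.r‖ / (1 - M.γ) := by
  have h1 : |nextValue M (discountedFrom M π fun s a => M.r s a k) s a| ≤ ‖M.r‖ / (1 - M.γ) :=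
    abs_simplex_sum_mul_le (M.P s a) (abs_discountedFrom_le M π fun s a => abs_r_le M s a k)
  have h2 : ‖M.r‖ / (1 - M.γ) = ‖M.r‖ + M.γ * (‖M.r‖ / (1 - M.γ)) := by
    have := one_sub_γ_pos M
    field_simp
    ring
  rw [qValue_eq, h2]
  refine (abs_add_le _ _).trans (add_le_add (abs_r_le M s a k) ?_)
  rw [abs_mul, abs_of_pos M.γ_pos]
  exact mul_le_mul_of_nonneg_left h1 M.γ_pos.le

theorem valueOfQ_qValue (M : MOMDP S A K) (π : Policy S A) (k : Fin K) :
    valueOfQ M π (qValue M π k) = value M π k := by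
  rw [valueOfQ, value, discounted_eq_sum]
  exact Finset.sum_congr rfl fun s _ => by rw [discountedFrom_bellman]; rfl

theorem abs_valueOfQ_sub_value_le (M : MOMDP S A K) (π : Policy S A) (k : Fin K) {q : S → A → ℝ}
    {δ : ℝ} (h : ∀ s a, |q s a - qValue M π k s a| ≤ δ) :
    |valueOfQ M π q - value M π k| ≤ δ := by
  rw [← valueOfQ_qValue, valueOfQ, valueOfQ, ← Finset.sum_sub_distrib]
  simp only [← mul_sub, ← Finset.sum_sub_distrib]
  exact abs_simplex_sum_mul_le M.μ fun s => abs_simplex_sum_mul_le (π s) fun a => h s a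

/-- Values are Lipschitz in the policy. -/
theorem abs_value_sub_le (M : MOMDP S A K) (π π' : Policy S A) {d : ℝ}
    (h : ∀ s, ∑ a, |π s a - π' s a| ≤ d) (k : Fin K) :
    |value M π k - value M π' k| ≤ d * (‖M.r‖ / (1 - M.γ)) / (1 - M.γ) := by
  have key : ∀ π π' : Policy S A, (∀ s, ∑ a, |π s a - π' s a| ≤ d) → ∀ s,
      discountedFrom M π (fun s a => M.r s a k) s - discountedFrom M π' (fun s a => M.r s a k) s
        ≤ d * (‖M.r‖ / (1 - M.γ)) / (1 - M.γ) := by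
    intro π π' h s
    refine le_div_of_le_bellman M π (D := fun s => discountedFrom M π (fun s a => M.r s a k) s -
      discountedFrom M π' (fun s a => M.r s a k) s) (fun s => ?_) s
    -- Performance difference: the gap of values solves the Bellman equation of `π` with source `∑
    -- a, (π s a - π' s a) * qValue M π' k s a`.
    have h1 := (abs_le.1 (abs_sum_mul_le (div_nonneg (norm_nonneg M.r) (one_sub_γ_pos M).le) (h s)
      (x := qValue M π' k s) fun a => abs_qValue_le M π' k s a)).2
    rw [discountedFrom_bellman M π, discountedFrom_bellman M π']
    refine le_trans (le_of_eq ?_) (add_le_add_left h1 _)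
    rw [Finset.mul_sum, ← Finset.sum_sub_distrib, ← Finset.sum_add_distrib]
    refine Finset.sum_congr rfl fun a _ => ?_
    rw [nextValue_sub, qValue_eq]
    ring
  have h' : ∀ s, ∑ a, |π' s a - π s a| ≤ d := fun s => by
    simpa only [abs_sub_comm] using h s
  rw [value, value, discounted_eq_sum, discounted_eq_sum, ← Finset.sum_sub_distrib]
  simp only [← mul_sub]
  refine abs_simplex_sum_mul_le M.μ fun s => abs_le.2 ⟨?_, key π π' h s⟩
  linarith [key π' π h' s]

/-- Soft action values of a policy against those of a soft optimal policy for another weight. -/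
theorem abs_softQ_sub_le [Nonempty A] (M : MOMDP S A K) {τ : ℝ} (hτ : 0 < τ)
    (πs π : Policy S A) {ws w : stdSimplex ℝ (Fin K)} {f : S → A → ℝ} {x z d : ℝ}
    (hs : ∀ s, (πs s : A → ℝ) = softmax fun a => softQ M τ πs ws s a / τ)
    (hπ : ∀ s, (π s : A → ℝ) = softmax fun a => f s a / τ)
    (hx : ∀ s a, |softQ M τ πs ws s a - f s a| ≤ x)
    (hz : ∀ s a, f s a - softQ M τ π w s a ≤ z)
    (hxz : 0 ≤ x + z) (hd : ∑ k, |ws k - w k| ≤ d) (s : S) (a : A) :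
    |softQ M τ πs ws s a - softQ M τ π w s a| ≤ M.γ * (x + z) + d * (‖M.r‖ / (1 - M.γ)) := by
  have hg := one_sub_γ_pos M
  have hd0 : 0 ≤ d := (Finset.sum_nonneg fun _ _ => abs_nonneg _).trans hd
  have hdr : 0 ≤ d * ‖M.r‖ := mul_nonneg hd0 (norm_nonneg _)
  have hid : d * (‖M.r‖ / (1 - M.γ)) = d * ‖M.r‖ + M.γ * (d * ‖M.r‖ / (1 - M.γ)) := by
    field_simp
    ring
  have hdr' : 0 ≤ M.γ * (d * ‖M.r‖ / (1 - M.γ)) :=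
    mul_nonneg M.γ_pos.le (div_nonneg hdr hg.le)
  have hVs : ∀ s, softV M τ πs ws s = softMaximum τ (softQ M τ πs ws s) := fun s => by
    rw [softV_eq]
    exact gibbs_softmax_eq_softMaximum hτ _ (hs s)
  -- The comparison passes through `softMaximum τ (f s)`: the first policy's value exceeds it by at
  -- most `x`, and `π`, being optimal for `f`, loses at most `z` against it.
  have hup : ∀ s, softV M τ πs ws s - softV M τ π w s ≤ x + z := by
    intro s
    have h1 : softV M τ πs ws s ≤ softMaximum τ (f s) + x := by
      rw [hVs]
      exact softMaximum_le_add hτ fun a => by linarith [(abs_le.1 (hx s a)).2]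
    have h2 : softMaximum τ (f s) ≤ softV M τ π w s + z := by
      rw [← gibbs_softmax_eq_softMaximum hτ _ (hπ s), softV_eq]
      exact simplex_sum_mul_le_add (π s) fun a => by linarith [hz s a]
    linarith
  have hd' : ∑ k, |w k - ws k| ≤ d := by simpa only [abs_sub_comm] using hd
  -- By soft optimality `softV M τ πs ws` is a supersolution for every policy under `ws`; only the
  -- change of weight costs anything.
  have hlo : ∀ s, softV M τ π w s - softV M τ πs ws s ≤ d * ‖M.r‖ / (1 - M.γ) := by
    intro s
    have := softV_le_of_bellman_le M τ π w (U := softV M τ πs ws) (c := d * ‖M.r‖) (fun s => ?_) s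
    · linarith
    · have h1 := gibbs_le_softMaximum hτ (softQ M τ πs ws s) (π s)
      rw [← hVs] at h1
      refine le_trans (simplex_sum_mul_le_add (π s) fun a => ?_) (add_le_add_left h1 _)
      have := (abs_le.1 (abs_scalarReward_sub_le M hd' s a)).2
      rw [softQ_eq]
      linarith
  have hu := softQ_sub_softQ_le M τ πs π hd hup s a
  have hl := softQ_sub_softQ_le M τ π πs hd' hlo s a
  have := mul_nonneg M.γ_pos.le hxz
  rw [abs_le]
  constructor <;> linarith

/-- Approximate policy improvement of the mirror ascent step, with a change of weights. -/
theorem softQ_sub_softQ_mirror_step_le [Nonempty A] (M : MOMDP S A K) {τ ε δ d : ℝ} (hτ : 0 < τ)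
    (hε : 0 < ε) (hε1 : ε ≤ 1) (hδ : 0 ≤ δ) (π π' : Policy S A) {w w' : stdSimplex ℝ (Fin K)}
    {f q : S → A → ℝ}
    (hπ : ∀ s, (π s : A → ℝ) = softmax fun a => f s a / τ)
    (hπ' : ∀ s, (π' s : A → ℝ) = softmax fun a => ((1 - ε) * f s a + ε * q s a) / τ)
    (hq : ∀ s a, |q s a - softQ M τ π w s a| ≤ δ) (hd : ∑ k, |w k - w' k| ≤ d) (s : S) (a : A) :
    softQ M τ π w s a - softQ M τ π' w' s a ≤
      d * (‖M.r‖ / (1 - M.γ)) + 2 * δ / (1 - M.γ) := by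
  have hg := one_sub_γ_pos M
  -- The old value is an approximate subsolution for the new policy and weight. The error `δ` enters
  -- twice: passing to `q` under `π`, and back under `π'`.
  have hV : ∀ s, softV M τ π w s - softV M τ π' w' s ≤ (2 * δ + d * ‖M.r‖) / (1 - M.γ) := by
    intro s
    have := le_softV_of_le_bellman M τ π' w' (U := softV M τ π w) (c := 2 * δ + d * ‖M.r‖)
      (fun s => ?_) s
    · linarith
    · have h1 : softV M τ π w s ≤ ∑ a, π s a * (q s a - τ * Real.log (π s a)) + δ := by
        rw [softV_eq]
        exact simplex_sum_mul_le_add (π s) fun a => by linarith [(abs_le.1 (hq s a)).1]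
      have h2 := gibbs_le_gibbs_mirror_step hτ hε hε1 (f s) (q s) (π s) (π' s) (hπ s) (hπ' s)
      have h3 : ∑ a, π' s a * (q s a - τ * Real.log (π' s a)) ≤
          ∑ a, π' s a * (scalarReward M w' s a + M.γ * nextValue M (softV M τ π w) s a
            - τ * Real.log (π' s a)) + (δ + d * ‖M.r‖) := by
        refine simplex_sum_mul_le_add (π' s) fun a => ?_
        have h4 := (abs_le.1 (hq s a)).2
        have h5 := (abs_le.1 (abs_scalarReward_sub_le M hd s a)).2
        rw [softQ_eq] at h4
        linarith
      linarith
  refine (softQ_sub_softQ_le M τ π π' hd hV s a).trans ?_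
  have : d * ‖M.r‖ + M.γ * ((2 * δ + d * ‖M.r‖) / (1 - M.γ)) =
      d * (‖M.r‖ / (1 - M.γ)) + M.γ * (2 * δ / (1 - M.γ)) := by
    field_simp
    ring
  rw [this]
  have h2 : 0 ≤ 2 * δ / (1 - M.γ) := by positivity
  nlinarith [M.γ_lt_one]

end MOMDP

/-! ### The algorithm in logarithmic coordinates and its contraction. -/

namespace MOMDP

/-- The multiplicative update is affine in unnormalized logarithms: the normalizer of `p`
contributes only a constant, which softmax ignores. -/
theorem softmax_of_rpow_mul_exp {ι : Type*} [Fintype ι] [Nonempty ι] {p p' x q : ι → ℝ}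
    {α κ : ℝ} (hp : p = softmax x)
    (hp' : ∀ i, p' i = (p i ^ α * Real.exp (κ * q i)) / ∑ j, p j ^ α * Real.exp (κ * q j)) :
    p' = softmax fun i => α * x i + κ * q i := by
  have h : ∀ i, p i ^ α * Real.exp (κ * q i) =
      Real.exp ((α * x i + κ * q i) + -(α * logSumExp x)) := by
    intro i
    rw [hp, Real.rpow_def_of_pos (softmax_pos x i), log_softmax, ← Real.exp_add]
    congr 1
    ring
  rw [← softmax_add_const _ (-(α * logSumExp x))]
  funext i
  rw [hp' i, softmax]
  simp only [h]

theorem softmax_add_mul_log_softmax {ι : Type*} [Fintype ι] [Nonempty ι] (v x : ι → ℝ) (β : ℝ) :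
    softmax (fun i => v i + β * Real.log (softmax x i)) = softmax fun i => β * x i + v i := by
  rw [← softmax_add_const (fun i => β * x i + v i) (-(β * logSumExp x))]
  congr 1
  funext i
  rw [log_softmax]
  ring

variable {S A : Type*} [Fintype S] [Fintype A] {K : ℕ}

/-- The iterate `(π, w)`, with unnormalized logarithms `f / τ` and `ν`, is within `c` of the
equilibrium `(πs, ws)`; `b` converts weight errors into value errors. -/
structure IterateBound (M : MOMDP S A K) (τ τw b : ℝ) (πs : Policy S A)
    (ws : stdSimplex ℝ (Fin K)) (c : ℝ) (f : S → A → ℝ) (ν : Fin K → ℝ) (π : Policy S A)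
    (w : stdSimplex ℝ (Fin K)) : Prop where
  policy_eq : ∀ s, (π s : A → ℝ) = softmax fun a => f s a / τ
  weight_eq : (w : Fin K → ℝ) = softmax ν
  abs_softQ_sub_le : ∀ s a, |softQ M τ πs ws s a - f s a| ≤ 3 / (1 - M.γ) * c
  sub_softQ_le : ∀ s a, f s a - softQ M τ π w s a ≤ c
  abs_weight_le : ∀ k, b * |ν k + value M πs k / τw| ≤ c

section Bounds

variable {M : MOMDP S A K} {τ τw b : ℝ} {πs : Policy S A} {ws : stdSimplex ℝ (Fin K)} {c : ℝ}
  {f : S → A → ℝ} {ν : Fin K → ℝ} {π : Policy S A} {w : stdSimplex ℝ (Fin K)}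

theorem IterateBound.sum_abs_weight_sub_le [Nonempty (Fin K)]
    (h : IterateBound M τ τw b πs ws c f ν π w) (hb : 0 < b)
    (hws : (ws : Fin K → ℝ) = softmax fun k => -value M πs k / τw) :
    ∑ k, |ws k - w k| ≤ c / b := by
  rw [hws, h.weight_eq]
  refine sum_abs_softmax_sub_le fun k => ?_
  rw [le_div_iff₀ hb, mul_comm, abs_sub_comm]
  have := h.abs_weight_le k
  rwa [show ν k - -value M πs k / τw = ν k + value M πs k / τw by ring]

theorem IterateBound.abs_softQ_sub_softQ_le [Nonempty A] [Nonempty (Fin K)]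
    (h : IterateBound M τ τw b πs ws c f ν π w) (hτ : 0 < τ) (hb : 0 < b) (hc : 0 ≤ c)
    (hrb : ‖M.r‖ ≤ b * (1 - M.γ))
    (hπs : ∀ s, (πs s : A → ℝ) = softmax fun a => softQ M τ πs ws s a / τ)
    (hws : (ws : Fin K → ℝ) = softmax fun k => -value M πs k / τw) (s : S) (a : A) :
    |softQ M τ πs ws s a - softQ M τ π w s a| ≤
      (M.γ * (3 / (1 - M.γ) + 1) + 1) * c := by
  have hg := one_sub_γ_pos M
  have hx : 0 ≤ 3 / (1 - M.γ) * c := by positivity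
  have h1 := MOMDP.abs_softQ_sub_le M hτ πs π hπs h.policy_eq h.abs_softQ_sub_le h.sub_softQ_le
    (by linarith) (h.sum_abs_weight_sub_le hb hws) s a
  have h2 : c / b * (‖M.r‖ / (1 - M.γ)) ≤ c := by
    calc c / b * (‖M.r‖ / (1 - M.γ)) ≤ c / b * b :=
          mul_le_mul_of_nonneg_left ((div_le_iff₀ hg).2 hrb) (by positivity)
      _ = c := div_mul_cancel₀ c hb.ne'
  linarith

theorem IterateBound.abs_value_sub_le [Nonempty A]
    (h : IterateBound M τ τw b πs ws c f ν π w) (hτ : 0 < τ)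
    (hπs : ∀ s, (πs s : A → ℝ) = softmax fun a => softQ M τ πs ws s a / τ) (k : Fin K) :
    |value M π k - value M πs k| ≤
      3 / (1 - M.γ) * c / τ * (‖M.r‖ / (1 - M.γ)) / (1 - M.γ) := by
  refine MOMDP.abs_value_sub_le M π πs (fun s => ?_) k
  rw [hπs s, h.policy_eq s]
  refine sum_abs_softmax_sub_le fun a => ?_
  rw [← sub_div, abs_div, abs_of_pos hτ, abs_sub_comm]
  exact div_le_div_of_nonneg_right (h.abs_softQ_sub_le s a) hτ.le

/-- One step of the algorithm contracts the error up to the estimation error. -/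
theorem IterateBound.step [Nonempty A] [Nonempty (Fin K)]
    (h : IterateBound M τ τw b πs ws c f ν π w) (hτ : 0 < τ) (hτw : 0 < τw) (hb : 0 < b)
    (hc : 0 ≤ c) (hrb : ‖M.r‖ ≤ b * (1 - M.γ)) (hb2 : 12 * b ^ 2 = τ * τw * (1 - M.γ) ^ 2)
    (hπs : ∀ s, (πs s : A → ℝ) = softmax fun a => softQ M τ πs ws s a / τ)
    (hws : (ws : Fin K → ℝ) = softmax fun k => -value M πs k / τw)
    {ε δ : ℝ} (hε : 0 < ε) (hεg : ε ≤ (1 - M.γ) / 4) (hδ : 0 ≤ δ)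
    {q : S → A → ℝ} {v : Fin K → ℝ} (hq : ∀ s a, |q s a - softQ M τ π w s a| ≤ δ)
    (hv : ∀ k, |v k - value M π k| ≤ δ) {π' : Policy S A} {w' : stdSimplex ℝ (Fin K)}
    (hπ' : ∀ s, (π' s : A → ℝ) = softmax fun a => ((1 - ε) * f s a + ε * q s a) / τ)
    (hw' : (w' : Fin K → ℝ) = softmax fun k => (1 - ε ^ 2) * ν k - ε ^ 2 / τw * v k) :
    IterateBound M τ τw b πs ws ((1 - 3 / 4 * ε ^ 2) * c + (1 + 2 / (1 - M.γ) + b / τw) * δ)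
      (fun s a => (1 - ε) * f s a + ε * q s a)
      (fun k => (1 - ε ^ 2) * ν k - ε ^ 2 / τw * v k) π' w' := by
  have hg := one_sub_γ_pos M
  have hγ := M.γ_pos
  have hε1 : ε ≤ 1 / 4 := by linarith
  have hε2 : ε ^ 2 ≤ ε / 4 := by nlinarith
  have hbτ : 0 ≤ b / τw * δ := by positivity
  have hgδ : 0 ≤ 2 / (1 - M.γ) * δ := by positivity
  -- The factor `1 / 4` is what the normalization `12 * b ^ 2 = τ * τw * (1 - γ) ^ 2` was chosen to
  -- give.
  have hverr : ∀ k, b * (|v k - value M πs k| / τw) ≤ c / 4 + b / τw * δ := by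
    intro k
    have h1 : |v k - value M πs k| ≤
        δ + 3 / (1 - M.γ) * c / τ * (‖M.r‖ / (1 - M.γ)) / (1 - M.γ) := by
      refine (abs_sub_le _ (value M π k) _).trans (add_le_add (hv k) ?_)
      exact h.abs_value_sub_le hτ hπs k
    have h2 : 3 / (1 - M.γ) * c / τ * (‖M.r‖ / (1 - M.γ)) / (1 - M.γ) ≤
        3 / (1 - M.γ) * c / τ * b / (1 - M.γ) := by
      have := (div_le_iff₀ hg).2 hrb
      gcongr
    have h3 : b * (3 / (1 - M.γ) * c / τ * b / (1 - M.γ) / τw) = c / 4 := by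
      have : b * (3 / (1 - M.γ) * c / τ * b / (1 - M.γ) / τw) =
          (12 * b ^ 2) * c / (4 * (τ * τw * (1 - M.γ) ^ 2)) := by
        field_simp
        ring
      rw [this, hb2]
      field_simp
    calc b * (|v k - value M πs k| / τw)
        ≤ b * ((δ + 3 / (1 - M.γ) * c / τ * b / (1 - M.γ)) / τw) := by
          gcongr
          linarith
      _ = c / 4 + b / τw * δ := by
          rw [add_div, mul_add, h3]
          ring
  have hνk : ∀ k, b * |ν k + v k / τw| ≤ c + (c / 4 + b / τw * δ) := by
    intro k
    have h1 : ν k + v k / τw =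
        (ν k + value M πs k / τw) + (v k - value M πs k) / τw := by ring
    have h2 := abs_add_le (ν k + value M πs k / τw) ((v k - value M πs k) / τw)
    rw [← h1, abs_div, abs_of_pos hτw] at h2
    have h3 := mul_le_mul_of_nonneg_left h2 hb.le
    linarith [h.abs_weight_le k, hverr k]
  refine ⟨hπ', hw', fun s a => ?_, fun s a => ?_, fun k => ?_⟩
  · have h1 := h.abs_softQ_sub_softQ_le hτ hb hc hrb hπs hws s a
    have h2 : softQ M τ πs ws s a - ((1 - ε) * f s a + ε * q s a) =
        (1 - ε) * (softQ M τ πs ws s a - f s a) +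
          ε * ((softQ M τ πs ws s a - softQ M τ π w s a) - (q s a - softQ M τ π w s a)) := by
      ring
    have h3 := abs_sub (softQ M τ πs ws s a - softQ M τ π w s a) (q s a - softQ M τ π w s a)
    have h4 : |softQ M τ πs ws s a - ((1 - ε) * f s a + ε * q s a)| ≤
        (1 - ε) * (3 / (1 - M.γ) * c) + ε * ((M.γ * (3 / (1 - M.γ) + 1) + 1) * c + δ) := by
      rw [h2]
      refine (abs_add_le _ _).trans (add_le_add ?_ ?_)
      · rw [abs_mul, abs_of_nonneg (by linarith : 0 ≤ 1 - ε)]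
        exact mul_le_mul_of_nonneg_left (h.abs_softQ_sub_le s a) (by linarith)
      · rw [abs_mul, abs_of_pos hε]
        exact mul_le_mul_of_nonneg_left (by linarith [hq s a]) hε.le
    refine h4.trans ?_
    -- The slack: `3 / (1 - γ)` exceeds `γ * (3 / (1 - γ) + 1) + 1` by exactly `2 - γ > 1`, while
    -- the claimed rate costs only `9 / 4 * (ε / (1 - γ)) ≤ 9 / 16`.
    have h5 : 3 / (1 - M.γ) * ((1 - 3 / 4 * ε ^ 2) * c + (1 + 2 / (1 - M.γ) + b / τw) * δ) -
        ((1 - ε) * (3 / (1 - M.γ) * c) + ε * ((M.γ * (3 / (1 - M.γ) + 1) + 1) * c + δ)) =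
        ε * c * ((2 - M.γ) - 9 / 4 * (ε / (1 - M.γ))) +
          (3 / (1 - M.γ) * (1 + 2 / (1 - M.γ) + b / τw) - ε) * δ := by
      field_simp
      ring
    have h6 : ε / (1 - M.γ) ≤ 1 / 4 := by
      rw [div_le_iff₀ hg]
      linarith
    have h7 : 1 ≤ 3 / (1 - M.γ) := by
      rw [le_div_iff₀ hg]
      linarith
    have h8 : 1 ≤ 1 + 2 / (1 - M.γ) + b / τw := by
      have : 0 ≤ 2 / (1 - M.γ) + b / τw := by positivity
      linarith
    have h9 : 0 ≤ 3 / (1 - M.γ) * (1 + 2 / (1 - M.γ) + b / τw) - ε := by nlinarith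
    have h10 : 0 ≤ (2 - M.γ) - 9 / 4 * (ε / (1 - M.γ)) := by linarith
    have h11 := mul_nonneg (mul_nonneg hε.le hc) h10
    have h12 := mul_nonneg h9 hδ
    linarith
  -- The weights move by order `ε ^ 2` only, so the action values they induce drift more slowly than
  -- `f` relaxes.
  · have hd : ∑ k, |w k - w' k| ≤ ε ^ 2 * ((c + (c / 4 + b / τw * δ)) / b) := by
      rw [h.weight_eq, hw']
      refine sum_abs_softmax_sub_le fun k => ?_
      have h1 : ν k - ((1 - ε ^ 2) * ν k - ε ^ 2 / τw * v k) = ε ^ 2 * (ν k + v k / τw) := by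
        ring
      rw [h1, abs_mul, abs_of_nonneg (sq_nonneg ε)]
      refine mul_le_mul_of_nonneg_left ?_ (sq_nonneg ε)
      rw [le_div_iff₀ hb, mul_comm]
      exact hνk k
    have h1 := softQ_sub_softQ_mirror_step_le M hτ hε (by linarith) hδ π π' h.policy_eq hπ' hq hd
      s a
    have h2 : ε ^ 2 * ((c + (c / 4 + b / τw * δ)) / b) * (‖M.r‖ / (1 - M.γ)) ≤
        ε ^ 2 * (c + (c / 4 + b / τw * δ)) := by
      calc ε ^ 2 * ((c + (c / 4 + b / τw * δ)) / b) * (‖M.r‖ / (1 - M.γ))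
          ≤ ε ^ 2 * ((c + (c / 4 + b / τw * δ)) / b) * b :=
            mul_le_mul_of_nonneg_left ((div_le_iff₀ hg).2 hrb) (by positivity)
        _ = ε ^ 2 * (c + (c / 4 + b / τw * δ)) := by field_simp
    have h3 := mul_le_mul_of_nonneg_left (h.sub_softQ_le s a) (by linarith : 0 ≤ 1 - ε)
    have h4 := mul_le_mul_of_nonneg_left (abs_le.1 (hq s a)).2 hε.le
    have h5 : 2 * δ / (1 - M.γ) = 2 / (1 - M.γ) * δ := by ring
    -- This turns the factor `1 - ε + 5 / 4 * ε ^ 2` into `1 - 3 / 4 * ε ^ 2`.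
    have h6 : 2 * ε ^ 2 * c ≤ ε * c := by
      have := mul_le_mul_of_nonneg_right hε2 hc
      nlinarith [mul_nonneg hε.le hc]
    have h7 : ε ^ 2 * (b / τw * δ) ≤ b / τw * δ :=
      mul_le_of_le_one_left hbτ (by linarith)
    have h8 : ε * δ ≤ δ := mul_le_of_le_one_left hδ (by linarith)
    linarith
  -- Here the rate is met exactly: `(1 - ε ^ 2) + ε ^ 2 / 4`.
  · have h1 : (1 - ε ^ 2) * ν k - ε ^ 2 / τw * v k + value M πs k / τw =
        (1 - ε ^ 2) * (ν k + value M πs k / τw) + ε ^ 2 * -((v k - value M πs k) / τw) := by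
      ring
    have hε3 : 0 ≤ 1 - ε ^ 2 := by linarith
    have h2 : |(1 - ε ^ 2) * ν k - ε ^ 2 / τw * v k + value M πs k / τw| ≤
        (1 - ε ^ 2) * |ν k + value M πs k / τw| + ε ^ 2 * (|v k - value M πs k| / τw) := by
      rw [h1]
      refine (abs_add_le _ _).trans (le_of_eq ?_)
      rw [abs_mul, abs_mul, abs_neg, abs_div, abs_of_pos hτw, abs_of_nonneg hε3,
        abs_of_nonneg (sq_nonneg ε)]
    have h3 := mul_le_mul_of_nonneg_left h2 hb.le
    have h4 := mul_le_mul_of_nonneg_left (h.abs_weight_le k) hε3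
    have h5 := mul_le_mul_of_nonneg_left (hverr k) (sq_nonneg ε)
    have h7 : ε ^ 2 * (b / τw * δ) ≤ b / τw * δ :=
      mul_le_of_le_one_left hbτ (by linarith)
    linarith

end Bounds

/-- Along a run, the distance to the equilibrium decays geometrically up to a multiple of the
estimation error. -/
theorem IsRun.exists_iterateBound [Nonempty A] [Nonempty (Fin K)] {M : MOMDP S A K}
    {τ τw b : ℝ} (hτ : 0 < τ) (hτw : 0 < τw) (hb : 0 < b)
    (hrb : ‖M.r‖ ≤ b * (1 - M.γ)) (hb2 : 12 * b ^ 2 = τ * τw * (1 - M.γ) ^ 2)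
    {πs : Policy S A} {ws : stdSimplex ℝ (Fin K)}
    (hπs : ∀ s, (πs s : A → ℝ) = softmax fun a => softQ M τ πs ws s a / τ)
    (hws : (ws : Fin K → ℝ) = softmax fun k => -value M πs k / τw)
    {ε η lam δ C : ℝ} (hε : 0 < ε) (hεg : ε ≤ (1 - M.γ) / 4) (hδ : 0 ≤ δ) (hC0 : 0 ≤ C)
    (hα : 1 - η * τ / (1 - M.γ) = 1 - ε) (hβ : 1 / (lam * τw + 1) = 1 - ε ^ 2)
    {Qhat : Policy S A → stdSimplex ℝ (Fin K) → S → A → ℝ}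
    {Qkhat : Policy S A → Fin K → S → A → ℝ}
    (hQ : ∀ π w, ‖Qhat π w - softQ M τ π w‖ ≤ δ) (hQk : ∀ π k, ‖Qkhat π k - qValue M π k‖ ≤ δ)
    {θ : ℕ → S → A → ℝ} {w : ℕ → stdSimplex ℝ (Fin K)}
    (hrun : IsRun M τ τw η lam Qhat Qkhat θ w) {f₀ : S → A → ℝ} {ν₀ : Fin K → ℝ}
    (h0 : IterateBound M τ τw b πs ws C f₀ ν₀ (softmaxPolicy (θ 0)) (w 0)) (t : ℕ) :
    ∃ f ν, IterateBound M τ τw b πs ws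
      (C * (1 - 3 / 4 * ε ^ 2) ^ t + 4 / 3 * (1 + 2 / (1 - M.γ) + b / τw) * (δ / ε ^ 2))
      f ν (softmaxPolicy (θ t)) (w t) := by
  have hg := one_sub_γ_pos M
  have hρ : 0 ≤ 1 - 3 / 4 * ε ^ 2 := by nlinarith [M.γ_pos]
  have hD : 0 ≤ 4 / 3 * (1 + 2 / (1 - M.γ) + b / τw) * (δ / ε ^ 2) := by positivity
  induction t with
  | zero =>
    refine ⟨f₀, ν₀, h0.1, h0.2, fun s a => (h0.3 s a).trans ?_,
      fun s a => (h0.4 s a).trans ?_, fun k => (h0.5 k).trans ?_⟩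
    · refine mul_le_mul_of_nonneg_left ?_ (by positivity)
      rw [pow_zero, mul_one]
      linarith
    all_goals
      rw [pow_zero, mul_one]
      linarith
  | succ t ih =>
    obtain ⟨f, ν, h⟩ := ih
    refine ⟨fun s a => (1 - ε) * f s a + ε * Qhat (softmaxPolicy (θ t)) (w t) s a,
      fun k => (1 - ε ^ 2) * ν k - ε ^ 2 / τw *
        valueOfQ M (softmaxPolicy (θ t)) (Qkhat (softmaxPolicy (θ t)) k), ?_⟩
    have hc : 0 ≤ C * (1 - 3 / 4 * ε ^ 2) ^ t +
        4 / 3 * (1 + 2 / (1 - M.γ) + b / τw) * (δ / ε ^ 2) :=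
      add_nonneg (mul_nonneg hC0 (pow_nonneg hρ t)) hD
    have hstep := h.step hτ hτw hb hc hrb hb2 hπs hws hε hεg hδ
      (q := Qhat (softmaxPolicy (θ t)) (w t))
      (v := fun k => valueOfQ M (softmaxPolicy (θ t)) (Qkhat (softmaxPolicy (θ t)) k))
      (fun s a => (abs_apply_le_norm (Qhat (softmaxPolicy (θ t)) (w t) -
        softQ M τ (softmaxPolicy (θ t)) (w t)) s a).trans (hQ _ _))
      (fun k => abs_valueOfQ_sub_value_le M _ k fun s a =>
        (abs_apply_le_norm (Qkhat (softmaxPolicy (θ t)) k -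
          qValue M (softmaxPolicy (θ t)) k) s a).trans (hQk _ _))
      (π' := softmaxPolicy (θ (t + 1))) (w' := w (t + 1)) ?_ ?_
    -- The additive term is the fixed point of `c ↦ (1 - 3 / 4 * ε ^ 2) * c + (1 + 2 / (1 - γ) + b /
    -- τw) * δ`, hence the factor `4 / 3` and the division by `ε ^ 2`.
    · convert hstep using 1
      rw [pow_succ]
      field_simp
      ring
    · intro s
      have h1 := hrun.policy_step t s
      simp only [hα] at h1
      rw [softmax_of_rpow_mul_exp (h.policy_eq s) h1]
      congr 1
      funext a
      ring
    · have h1 := hrun.weight_step t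
      simp only [hβ] at h1
      rw [h.weight_eq] at h1
      rw [funext h1]
      funext k
      rw [softmax_add_mul_log_softmax]
      congr 1
      funext j
      ring

/-- The two demands on `b` are compatible: it must be large enough to control rewards, yet `b ^ 2`
is tied to `τ * τw`. Only `12 * ‖r‖ ^ 2 ≤ τ * τw * (1 - γ) ^ 4` is needed; the factor `K` and the
entropy term are dropped. -/
theorem norm_r_le_of_regularization {M : MOMDP S A K} [Nonempty A] {τ τw b : ℝ} (hτ : 0 < τ)
    (hK : 1 ≤ K)
    (hreg : 12 * K * (‖M.r‖ + τ * Real.log (Fintype.card A)) ^ 2 / (τ * (1 - M.γ) ^ 4) ≤ τw)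
    (hb : 0 < b) (hb2 : 12 * b ^ 2 = τ * τw * (1 - M.γ) ^ 2) : ‖M.r‖ ≤ b * (1 - M.γ) := by
  have hg := one_sub_γ_pos M
  have hlog : 0 ≤ τ * Real.log (Fintype.card A) := mul_nonneg hτ.le (Real.log_natCast_nonneg _)
  rw [div_le_iff₀ (by positivity)] at hreg
  have hK' : (1 : ℝ) ≤ K := by exact_mod_cast hK
  have h1 : ‖M.r‖ ^ 2 ≤ (‖M.r‖ + τ * Real.log (Fintype.card A)) ^ 2 :=
    pow_le_pow_left₀ (norm_nonneg _) (by linarith) 2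
  have h2 : (‖M.r‖ + τ * Real.log (Fintype.card A)) ^ 2 ≤
      K * (‖M.r‖ + τ * Real.log (Fintype.card A)) ^ 2 :=
    le_mul_of_one_le_left (sq_nonneg _) hK'
  have h3 : τw * (τ * (1 - M.γ) ^ 4) = 12 * (b * (1 - M.γ)) ^ 2 := by
    calc τw * (τ * (1 - M.γ) ^ 4) = (τ * τw * (1 - M.γ) ^ 2) * (1 - M.γ) ^ 2 := by ring
      _ = 12 * (b * (1 - M.γ)) ^ 2 := by rw [← hb2]; ring
  refine le_of_sq_le_sq ?_ (by positivity)
  linarith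

end MOMDP

/-- Norms of functions on finite products are sup norms; in particular `‖M.r‖` is
`max_{s,a,k} |r_k(s,a)|`. The condition `_hsel` is void if `μ` charges every state; at the other
states it fixes the equilibrium policy, which the equilibrium property need not determine there,
as the soft optimal one. -/
theorem mainTheorem3 :
    ∃ ε₀ : ℝ → ℝ, (∀ γ : ℝ, 0 < γ → γ < 1 → 0 < ε₀ γ) ∧
    ∀ (S : Type*) (A : Type*) [Fintype S] [Fintype A] [Nonempty A] (K : ℕ)
      (M : MOMDP S A K) (τ τw : ℝ) (_hτ : 0 < τ) (_hτw : 0 < τw)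
      (_hreg : 12 * K * (‖M.r‖ + τ * Real.log (Fintype.card A)) ^ 2 / (τ * (1 - M.γ) ^ 4) ≤ τw),
    ∃ (ρ : ℝ → ℝ → ℝ) (D₁ D₂ D₃ : ℝ),
      (∀ ε : ℝ, 0 < ε → ε < ε₀ M.γ →
        0 < ρ (ε * (1 - M.γ) / τ) (ε ^ 2 / (τw * (1 - ε ^ 2))) ∧
        ρ (ε * (1 - M.γ) / τ) (ε ^ 2 / (τw * (1 - ε ^ 2))) < 1 - ε ^ 2 / 2 ∧
        1 - ε ^ 2 / 2 < 1) ∧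
      ∀ (θstar : S → A → ℝ) (wstar : stdSimplex ℝ (Fin K))
        (_hNash : MOMDP.IsNash M τ τw θstar wstar)
        (_hsel : ∀ s, M.μ s = 0 → ∀ θ' : S → A → ℝ,
          MOMDP.softV M τ (MOMDP.softmaxPolicy θ') wstar s ≤
            MOMDP.softV M τ (MOMDP.softmaxPolicy θstar) wstar s)
        (θ₀ : S → A → ℝ) (w₀ : stdSimplex ℝ (Fin K)) (_hw₀ : ∀ k, 0 < w₀ k),
      ∃ C₁ C₂ C₃ : ℝ,
        ∀ (ε η lam δ : ℝ) (_hε : 0 < ε) (_hε₀ : ε < ε₀ M.γ)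
          (_hη : η = ε * (1 - M.γ) / τ) (_hlam : lam = ε ^ 2 / (τw * (1 - ε ^ 2)))
          (Qhat : MOMDP.Policy S A → stdSimplex ℝ (Fin K) → S → A → ℝ)
          (Qkhat : MOMDP.Policy S A → Fin K → S → A → ℝ)
          (_hQ : ∀ π w, ‖Qhat π w - MOMDP.softQ M τ π w‖ < δ)
          (_hQk : ∀ π k, ‖Qkhat π k - MOMDP.qValue M π k‖ < δ)
          (θ : ℕ → S → A → ℝ) (w : ℕ → stdSimplex ℝ (Fin K))
          (_hθ₀ : θ 0 = θ₀) (_hw0 : w 0 = w₀)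
          (_hrun : MOMDP.IsRun M τ τw η lam Qhat Qkhat θ w) (t : ℕ),
          ‖(fun s a => Real.log (MOMDP.softmaxPolicy θstar s a)
              - Real.log (MOMDP.softmaxPolicy (θ t) s a) : S → A → ℝ)‖
            ≤ C₁ * ρ η lam ^ t + D₁ * δ / ε ^ 2 ∧
          ‖(fun k => wstar k - w t k : Fin K → ℝ)‖
            ≤ C₂ * ρ η lam ^ t + D₂ * δ / ε ^ 2 ∧
          ‖MOMDP.softQ M τ (MOMDP.softmaxPolicy θstar) wstar
              - MOMDP.softQ M τ (MOMDP.softmaxPolicy (θ t)) (w t)‖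
            ≤ C₃ * ρ η lam ^ t + D₃ * δ / ε ^ 2 := by
  refine ⟨fun γ => (1 - γ) / 4, fun γ _ h => by linarith, ?_⟩
  intro S A _ _ _ K M τ τw hτ hτw hreg
  have hg := MOMDP.one_sub_γ_pos M
  set b : ℝ := (1 - M.γ) * √(τ * τw / 12) with hbdef
  have hb : 0 < b := by positivity
  have hb2 : 12 * b ^ 2 = τ * τw * (1 - M.γ) ^ 2 := by
    rw [hbdef, mul_pow, Real.sq_sqrt (by positivity)]
    ring
  set D : ℝ := 4 / 3 * (1 + 2 / (1 - M.γ) + b / τw)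
  have hβ : ∀ ε : ℝ, 0 < ε → ε < (1 - M.γ) / 4 →
      1 / (ε ^ 2 / (τw * (1 - ε ^ 2)) * τw + 1) = 1 - ε ^ 2 := by
    intro ε hε hε₀
    have : 0 < 1 - ε ^ 2 := by nlinarith [M.γ_pos]
    field_simp
    ring
  -- The slow time scale sets the rate: `1 - 1 / (lam * τw + 1)` equals `ε ^ 2`, so `ρ` depends on
  -- `lam` alone and equals `1 - 3 / 4 * ε ^ 2`.
  refine ⟨fun _ lam => 1 - 3 / 4 * (1 - 1 / (lam * τw + 1)), 2 * (3 / (1 - M.γ)) / τ * D,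
    1 / b * D, (M.γ * (3 / (1 - M.γ) + 1) + 1) * D, ?_, ?_⟩
  · intro ε hε hε₀
    have h2 : 0 < ε ^ 2 := by positivity
    simp only [hβ ε hε hε₀]
    refine ⟨?_, ?_, ?_⟩ <;> nlinarith [M.γ_pos]
  intro θstar wstar hNash hsel θ₀ w₀ hw₀
  have hπs := hNash.policy_eq_softmax hτ hsel
  have hws := hNash.weight_eq_softmax hτw
  set πs := MOMDP.softmaxPolicy θstar
  have hne : Nonempty (Fin K) := by
    by_contra h
    rw [not_nonempty_iff] at h
    simpa using MOMDP.simplex_sum wstar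
  have hK : 1 ≤ K := Fin.pos_iff_nonempty.2 hne
  have hrb := MOMDP.norm_r_le_of_regularization hτ hK hreg hb hb2
  -- `X`, `Z` and `Y` are the three initial errors for the coordinates `τ * θ₀` and `log w₀`; none
  -- involves `ε`, so neither does `C`.
  set X : S → A → ℝ := fun s a => MOMDP.softQ M τ πs wstar s a - τ * θ₀ s a
  set Z : S → A → ℝ := fun s a =>
    τ * θ₀ s a - MOMDP.softQ M τ (MOMDP.softmaxPolicy θ₀) w₀ s a
  set Y : Fin K → ℝ := fun k => Real.log (w₀ k) + MOMDP.value M πs k / τw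
  set C : ℝ := ‖X‖ + ‖Z‖ + b * ‖Y‖ with hC
  have hX := norm_nonneg X
  have hZ := norm_nonneg Z
  have hY : 0 ≤ b * ‖Y‖ := by positivity
  have hC0 : 0 ≤ C := by positivity
  have hinit : MOMDP.IterateBound M τ τw b πs wstar C (fun s a => τ * θ₀ s a)
      (fun k => Real.log (w₀ k)) (MOMDP.softmaxPolicy θ₀) w₀ := by
    refine ⟨fun s => ?_, (MOMDP.softmax_log hw₀ (MOMDP.simplex_sum w₀)).symm, fun s a => ?_,
      fun s a => ?_, fun k => ?_⟩
    · simp only [mul_div_cancel_left₀ _ hτ.ne']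
      rfl
    · refine (MOMDP.abs_apply_le_norm X s a).trans ?_
      have : 1 ≤ 3 / (1 - M.γ) := by
        rw [le_div_iff₀ hg]
        linarith [M.γ_pos]
      exact le_trans (by linarith) (le_mul_of_one_le_left hC0 this)
    · exact ((le_abs_self _).trans (MOMDP.abs_apply_le_norm Z s a)).trans (by linarith)
    · exact (mul_le_mul_of_nonneg_left (norm_le_pi_norm Y k) hb.le).trans (by linarith)
  refine ⟨2 * (3 / (1 - M.γ)) / τ * C, 1 / b * C, (M.γ * (3 / (1 - M.γ) + 1) + 1) * C, ?_⟩
  intro ε η lam δ hε hε₀ hη hlam Qhat Qkhat hQ hQk θ w hθ₀ hw0 hrun t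
  have hδ : 0 ≤ δ := (norm_nonneg _).trans (hQ πs wstar).le
  have hβ' := hβ ε hε hε₀
  rw [← hlam] at hβ'
  have hα : 1 - η * τ / (1 - M.γ) = 1 - ε := by
    rw [hη]
    field_simp
  obtain ⟨f, ν, h⟩ := hrun.exists_iterateBound hτ hτw hb hrb hb2 hπs hws hε hε₀.le hδ hC0 hα hβ'
    (fun π w => (hQ π w).le) (fun π k => (hQk π k).le) (by rw [hθ₀, hw0]; exact hinit) t
  have hρ : 1 - 3 / 4 * (1 - 1 / (lam * τw + 1)) = 1 - 3 / 4 * ε ^ 2 := by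
    rw [hβ']
    ring
  simp only [hρ]
  set c : ℝ := C * (1 - 3 / 4 * ε ^ 2) ^ t + D * (δ / ε ^ 2) with hc
  have hρ0 : 0 ≤ 1 - 3 / 4 * ε ^ 2 := by nlinarith [M.γ_pos]
  have hc0 : 0 ≤ c := by positivity
  have split : ∀ m : ℝ, m * C * (1 - 3 / 4 * ε ^ 2) ^ t + m * D * δ / ε ^ 2 = m * c := by
    intro m
    rw [hc]
    ring
  rw [split, split, split]
  have hm : 0 ≤ M.γ * (3 / (1 - M.γ) + 1) + 1 := by
    have := M.γ_pos
    positivity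
  refine ⟨?_, ?_, ?_⟩
  · have hm' : 0 ≤ 2 * (3 / (1 - M.γ)) / τ * c := by positivity
    refine (pi_norm_le_iff_of_nonneg hm').2 fun s => (pi_norm_le_iff_of_nonneg hm').2 fun a => ?_
    rw [hπs s, h.policy_eq s, Real.norm_eq_abs]
    refine (MOMDP.abs_log_softmax_sub_le (d := 3 / (1 - M.γ) * c / τ) (fun a => ?_) a).trans
      (le_of_eq (by ring))
    rw [← sub_div, abs_div, abs_of_pos hτ]
    exact div_le_div_of_nonneg_right (h.abs_softQ_sub_le s a) hτ.le
  · refine (pi_norm_le_iff_of_nonneg (by positivity)).2 fun k => ?_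
    refine (Finset.single_le_sum (f := fun k => |wstar k - w t k|) (fun _ _ => abs_nonneg _)
      (Finset.mem_univ k)).trans ((h.sum_abs_weight_sub_le hb hws).trans (le_of_eq (by ring)))
  · have hm' := mul_nonneg hm hc0
    exact (pi_norm_le_iff_of_nonneg hm').2 fun s => (pi_norm_le_iff_of_nonneg hm').2 fun a =>
      h.abs_softQ_sub_softQ_le hτ hb hc0 hrb hπs hws s a
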